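/- Let $k\ge 3$. Let $C=C_k=(c_{ij})_{1\le i,j\le k}$ be the generalized Cartan matrix of type $E_k$: $c_{ii}=2$, and for $i\ne j$ one has $c_{ij}=-1$ if the nodes $i,j$ are joined in the following diagram and $c_{ij}=0$ otherwise: the nodes $1,\dots,k-1$ form a line in this order, and the node $k$ is joined to the node $3$ only (to no node if $k=3$). Let $\mathfrak h_k$ be the real vector space with basis $h_0,\dots,h_k$ and the Minkowski inner product for which this basis is orthogonal, $(h_0,h_0)=-1$ and $(h_i,h_i)=1$ for $1\le i\le k$. Let $\varepsilon_j=(h_j,\cdot)\in\mathfrak h_k^*$, and put $$\alpha_i=\varepsilon_i-\varepsilon_{i+1},\quad \alpha_i^\vee=h_i-h_{i+1}\quad(1\le i\le k-1),\qquad \alpha_k=\varepsilon_0-\varepsilon_1-\varepsilon_2-\varepsilon_3,\quad \alpha_k^\vee=h_0-h_1-h_2-h_3,$$ and $K_k=-3h_0+\sum_{i=1}^k h_i$. For a field $F$ of characteristic $0$, an $F$-vector space $V$, and families $\beta_i\in V^*$, $\beta_i^\vee\in V$ $(1\le i\le k)$, let $\mathfrak g_F(V,\beta,\beta^\vee)$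 be the Lie algebra over $F$ generated by the vector space $V$ (with its linear structure) and $e_1,\dots,e_k,f_1,\dots,f_k$ with relations $[h,h']=0$, $[h,e_i]=\beta_i(h)e_i$, $[h,f_i]=-\beta_i(h)f_i$, $[e_i,f_j]=\delta_{ij}\beta_i^\vee$, and $\operatorname{ad}(e_i)^{1-a_{ij}}(e_j)=\operatorname{ad}(f_i)^{1-a_{ij}}(f_j)=0$ for $i\ne j$, where $a_{ij}=\beta_j(\beta_i^\vee)$. Put $\mathfrak g_k=\mathfrak g_{\mathbb R}(\mathfrak h_k,\alpha,\alpha^\vee)$. For $k\neq 9$ let $\mathfrak e_k(F)$ be the Lie algebra over $F$ with generators $h_i,e_i,f_i$ $(1\le i\le k)$ and relations $[h_i,h_j]=0$, $[h_i,e_j]=c_{ij}e_j$, $[h_i,f_j]=-c_{ij}f_j$, $[e_i,f_j]=\delta_{ij}h_i$, and $\operatorname{ad}(e_i)^{1-c_{ij}}(e_j)=\operatorname{ad}(f_i)^{1-c_{ij}}(f_j)=0$ for $i\ne j$; write $\mathfrak e_{k(k)}=\mathfrak e_k(\mathbb R)$ and $\mathfrak e_k=\mathfrak e_k(\mathbb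 C)$. For $k=9$, the Kac–Moody algebra of type $E_9$ over $F$ is $\mathfrak g_F(V,\beta,\beta^\vee)$ for a realization $(V,\beta,\beta^\vee)$ of $C_9$ over $F$, i.e. $V$ is finite-dimensional, the $\beta_i$ are linearly independent, the $\beta_i^\vee$ are linearly independent, $\beta_j(\beta_i^\vee)=c_{ij}$, and $\dim V=2\cdot 9-\operatorname{rank}C_9$; it is $\mathfrak e_{9(9)}$ for $F=\mathbb R$ and $\mathfrak e_9$ for $F=\mathbb C$. Then the following hold. (i) Let $3\le k\le 8$. Over $F=\mathbb R$ and over $F=\mathbb C$, $\mathfrak e_k(F)$ is a finite-dimensional semisimple Lie algebra with a splitting Cartan subalgebra whose root system has a base with Cartan matrix $C_k$. The algebra $\mathfrak e_{k(k)}$ is the standard split real form of $\mathfrak e_k$: there is an isomorphism $\mathbb C\otimes_{\mathbb R}\mathfrak e_{k(k)}\cong\mathfrak e_k$ matching the generators $h_i,e_i,f_i$. The algebra $\mathfrak g_k$ is the trivial one-dimensional central extension of $\mathfrak e_{k(k)}$: there is an isomorphism of Lie algebras $\mathfrak g_k\cong\mathbb R\times\mathfrak e_{k(k)}$, with $\mathbb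 R$ abelian, under which $K_k\mapsto(1,0)$, $\alpha_i^\vee\mapsto(0,h_i)$, $e_i\mapsto(0,e_i)$, $f_i\mapsto(0,f_i)$. (ii) The matrix $C_9$ is of affine type, that is, it is an indecomposable generalized Cartan matrix of corank $1$, there is $u>0$ with $C_9u=0$, and $C_9v\ge0$ implies $C_9v=0$ for real $v$. The triple $(\mathfrak h_9,\alpha,\alpha^\vee)$ is a realization of $C_9$ over $\mathbb R$. The algebra $\mathfrak g_9$ is the split real form $\mathfrak e_{9(9)}$: for every realization $(V,\beta,\beta^\vee)$ of $C_9$ over $\mathbb R$ there is an isomorphism $\mathfrak g_9\cong\mathfrak g_{\mathbb R}(V,\beta,\beta^\vee)$ which maps $e_i\mapsto e_i$, $f_i\mapsto f_i$ and is given on the Cartan spaces by a linear isomorphism $\mathfrak h_9\cong V$ matching $\alpha_i$ with $\beta_i$ and $\alpha_i^\vee$ with $\beta_i^\vee$; and likewise, for every realization $(W,\beta,\beta^\vee)$ of $C_9$ over $\mathbb C$, there is such an isomorphism $\mathbb C\otimes_{\mathbb R}\mathfrak g_9\cong\mathfrak g_{\mathbb C}(W,\beta,\beta^\vee)$. (iii)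 Let $k\ge10$. The matrix $C_k$ is of indefinite type, that is, it is an indecomposable generalized Cartan matrix, there is $u>0$ with $C_ku<0$, and $C_kv\ge0$, $v\ge0$ imply $v=0$ for real $v$ (inequalities between vectors are componentwise). The algebra $\mathfrak e_{k(k)}$ is the standard split real form of $\mathfrak e_k$, and $\mathfrak g_k$ is the trivial one-dimensional central extension of $\mathfrak e_{k(k)}$, both in the sense of (i). -/

import Mathlib

open scoped TensorProduct

/-! ### Lie algebras given by Chevalley generators over a Cartan space -/

section Chevalley

/-- Generators: the elements of the Cartan space `V`, and letters `e i`, `f i`. -/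
inductive ChevalleyGenerator (V ι : Type*)
  | h : V → ChevalleyGenerator V ι
  | e : ι → ChevalleyGenerator V ι
  | f : ι → ChevalleyGenerator V ι

variable (K : Type*) {V ι : Type*} [Field K] [AddCommGroup V] [Module K V]

/-- A generator, as an element of the free Lie algebra. -/
noncomputable abbrev freeGen (K V ι : Type*) [Field K] (x : ChevalleyGenerator V ι) :
    FreeLieAlgebra K (ChevalleyGenerator V ι) :=
  FreeLieAlgebra.of K x

/-- `ChevalleyRelator K α αv x`: the element `x` of the free Lie algebra is one of the elements
that the defining relations set to zero. Here `α i` are the simple roots, `αv i` the simple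
coroots, and the Cartan matrix is `c i j = α j (αv i)`. The constructors `add` and `smul` say that
the elements of `V` are added and scaled as in `V`. -/
inductive ChevalleyRelator (α : ι → Module.Dual K V) (αv : ι → V) :
    FreeLieAlgebra K (ChevalleyGenerator V ι) → Prop
  | add (x y : V) : ChevalleyRelator α αv
      (freeGen K V ι (.h (x + y)) -
        (freeGen K V ι (.h x) + freeGen K V ι (.h y)))
  | smul (c : K) (x : V) : ChevalleyRelator α αv
      (freeGen K V ι (.h (c • x)) - c • freeGen K V ι (.h x))
  | hh (x y : V) : ChevalleyRelator α αv
      ⁅freeGen K V ι (.h x), freeGen K V ι (.h y)⁆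
  | he (x : V) (i : ι) : ChevalleyRelator α αv
      (⁅freeGen K V ι (.h x), freeGen K V ι (.e i)⁆ -
        α i x • freeGen K V ι (.e i))
  | hf (x : V) (i : ι) : ChevalleyRelator α αv
      (⁅freeGen K V ι (.h x), freeGen K V ι (.f i)⁆ +
        α i x • freeGen K V ι (.f i))
  | ef_same (i : ι) : ChevalleyRelator α αv
      (⁅freeGen K V ι (.e i), freeGen K V ι (.f i)⁆ -
        freeGen K V ι (.h (αv i)))
  | ef_ne (i j : ι) (hij : i ≠ j) : ChevalleyRelator α αv
      ⁅freeGen K V ι (.e i), freeGen K V ι (.f j)⁆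
  | serre_e (i j : ι) (hij : i ≠ j) (n : ℕ) (hn : (n : K) = 1 - α j (αv i)) :
      ChevalleyRelator α αv
      (((LieAlgebra.ad K _ (freeGen K V ι (.e i))) ^ n) (freeGen K V ι (.e j)))
  | serre_f (i j : ι) (hij : i ≠ j) (n : ℕ) (hn : (n : K) = 1 - α j (αv i)) :
      ChevalleyRelator α αv
      (((LieAlgebra.ad K _ (freeGen K V ι (.f i))) ^ n) (freeGen K V ι (.f j)))

/-- The ideal of the free Lie algebra generated by the defining relations. -/
noncomputable def chevalleyIdeal (α : ι → Module.Dual K V) (αv : ι → V) :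
    LieIdeal K (FreeLieAlgebra K (ChevalleyGenerator V ι)) :=
  LieSubmodule.lieSpan K _ {x | ChevalleyRelator K α αv x}

/-- The Lie algebra over `K` with generators the elements of `V` and `e i`, `f i`, and relations
`[h, h'] = 0`, `[h, e i] = α i (h) e i`, `[h, f i] = - α i (h) f i`, `[e i, f j] = δ i j • αv i`,
and, for `i ≠ j`, `ad (e i) ^ (1 - c i j) (e j) = 0` and `ad (f i) ^ (1 - c i j) (f j) = 0` with
`c i j = α j (αv i)`. When `(V, α, αv)` is a realization of a generalized Cartan matrix, this is
the Kac-Moody algebra over `K` of that matrix. -/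
def ChevalleyAlgebra (α : ι → Module.Dual K V) (αv : ι → V) : Type _ :=
  FreeLieAlgebra K (ChevalleyGenerator V ι) ⧸ chevalleyIdeal K α αv

noncomputable instance (α : ι → Module.Dual K V) (αv : ι → V) :
    LieRing (ChevalleyAlgebra K α αv) :=
  inferInstanceAs (LieRing (FreeLieAlgebra K (ChevalleyGenerator V ι) ⧸ chevalleyIdeal K α αv))

noncomputable instance (α : ι → Module.Dual K V) (αv : ι → V) :
    LieAlgebra K (ChevalleyAlgebra K α αv) :=
  inferInstanceAs
    (LieAlgebra K (FreeLieAlgebra K (ChevalleyGenerator V ι) ⧸ chevalleyIdeal K α αv))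

/-- The image of a generator in the Lie algebra. -/
noncomputable def ChevalleyAlgebra.gen (α : ι → Module.Dual K V) (αv : ι → V)
    (x : ChevalleyGenerator V ι) : ChevalleyAlgebra K α αv :=
  LieSubmodule.Quotient.mk (N := chevalleyIdeal K α αv) (FreeLieAlgebra.of K x)

/-- `(V, α, αv)` is a realization over `K` of the square matrix `A` of size `n`: the `α i` are
linearly independent in the dual of `V`, the `αv i` are linearly independent in `V`,
`α j (αv i) = A i j`, and `n - rank A = dim V - n`. -/
structure IsRealization [Fintype ι] (A : Matrix ι ι ℤ) (α : ι → Module.Dual K V)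
    (αv : ι → V) : Prop where
  finite : Module.Finite K V
  root_indep : LinearIndependent K α
  coroot_indep : LinearIndependent K αv
  pairing : ∀ i j, α j (αv i) = (A i j : K)
  dim : Module.finrank K V + (A.map (Int.cast : ℤ → K)).rank = 2 * Fintype.card ι

end Chevalley

/-! ### Generalized Cartan matrices and their types -/

section CartanMatrices

variable {ι : Type*}

/-- Indecomposable generalized Cartan matrices. -/
structure IsIndecomposableGCM (A : Matrix ι ι ℤ) : Prop where
  diag : ∀ i, A i i = 2
  off_diag : ∀ i j, i ≠ j → A i j ≤ 0
  zero : ∀ i j, A i j = 0 → A j i = 0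
  indecomposable : ∀ S : Set ι, S.Nonempty → Sᶜ.Nonempty → ∃ i ∈ S, ∃ j ∈ Sᶜ, A i j ≠ 0

/-- Affine type: an indecomposable generalized Cartan matrix of corank `1` such that `A u = 0` for
some `u > 0`, and `A v ≥ 0` implies `A v = 0`. -/
structure IsAffineType [Fintype ι] (A : Matrix ι ι ℤ) : Prop extends IsIndecomposableGCM A where
  corank : (A.map (Int.cast : ℤ → ℝ)).rank + 1 = Fintype.card ι
  exists_pos : ∃ u : ι → ℝ, (∀ i, 0 < u i) ∧ (A.map (Int.cast : ℤ → ℝ)).mulVec u = 0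
  eq_zero : ∀ v : ι → ℝ, (∀ i, 0 ≤ (A.map (Int.cast : ℤ → ℝ)).mulVec v i) →
    (A.map (Int.cast : ℤ → ℝ)).mulVec v = 0

/-- Indefinite type: an indecomposable generalized Cartan matrix such that `A u < 0` for some
`u > 0`, and `A v ≥ 0`, `v ≥ 0` imply `v = 0`. -/
structure IsIndefiniteType [Fintype ι] (A : Matrix ι ι ℤ) : Prop
    extends IsIndecomposableGCM A where
  exists_pos : ∃ u : ι → ℝ, (∀ i, 0 < u i) ∧
    ∀ i, (A.map (Int.cast : ℤ → ℝ)).mulVec u i < 0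
  eq_zero : ∀ v : ι → ℝ, (∀ i, 0 ≤ (A.map (Int.cast : ℤ → ℝ)).mulVec v i) →
    (∀ i, 0 ≤ v i) → v = 0

/-- `L` is a finite-dimensional semisimple Lie algebra over `K` which has a splitting Cartan
subalgebra (one whose elements act on `L` with all eigenvalues in `K`) such that the resulting
root system has a base with Cartan matrix `A`. -/
def IsSplitSemisimpleOfType (K L : Type*) [Field K] [CharZero K] [LieRing L] [LieAlgebra K L]
    (A : Matrix ι ι ℤ) : Prop :=
  ∃ (_ : FiniteDimensional K L) (_ : LieAlgebra.IsSemisimple K L)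
    (H : LieSubalgebra K L) (_ : H.IsCartanSubalgebra) (_ : LieModule.IsTriangularizable K H L)
    (b : (LieAlgebra.IsKilling.rootSystem H).Base) (σ : ι ≃ b.support),
    ∀ i j, b.cartanMatrix (σ i) (σ j) = A i j

end CartanMatrices

/-! ### The series `E_k` -/

namespace ESeries

/-- The generalized Cartan matrix of type `E_k`. The index `i : Fin k` stands for the node number
`i + 1`. Nodes `1, …, k - 1` form a line, and node `k` is joined to node `3` (to no node if
`k = 3`). -/
def cartanMatrix (k : ℕ) : Matrix (Fin k) (Fin k) ℤ := fun i j =>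
  if i = j then 2
  else if (i.val + 1 = j.val ∧ j.val + 1 < k) ∨ (j.val + 1 = i.val ∧ i.val + 1 < k) ∨
      (i.val + 1 = 3 ∧ j.val + 1 = k) ∨ (j.val + 1 = 3 ∧ i.val + 1 = k) then -1
  else 0

/-- The real vector space `𝔥_k` with basis `h_0, …, h_k`. -/
abbrev Cartan (k : ℕ) : Type := Fin (k + 1) → ℝ

/-- The basis vector `h_j`, for `0 ≤ j ≤ k`. -/
def hvec (k j : ℕ) : Cartan k := fun m => if m.val = j then 1 else 0

/-- The Minkowski inner product, with `(h_0, h_0) = -1` and `(h_i, h_i) = 1` for `i ≥ 1`. -/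
noncomputable def minkowski (k : ℕ) : LinearMap.BilinForm ℝ (Cartan k) :=
  Matrix.toBilin' (Matrix.diagonal fun i : Fin (k + 1) => if i = 0 then (-1 : ℝ) else 1)

/-- `ε_j`, the image of `h_j` in the dual space under the map induced by the inner product. -/
noncomputable def eps (k j : ℕ) : Module.Dual ℝ (Cartan k) := minkowski k (hvec k j)

/-- Simple roots: `α_i = ε_i - ε_{i+1}` for `1 ≤ i ≤ k - 1`, and
`α_k = ε_0 - ε_1 - ε_2 - ε_3`. The index `i : Fin k` stands for `i + 1`. -/
noncomputable def root (k : ℕ) (i : Fin k) : Module.Dual ℝ (Cartan k) :=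
  if i.val + 1 < k then eps k (i.val + 1) - eps k (i.val + 2)
  else eps k 0 - eps k 1 - eps k 2 - eps k 3

/-- Simple coroots: `h_i - h_{i+1}` for `1 ≤ i ≤ k - 1`, and `h_0 - h_1 - h_2 - h_3`. -/
def coroot (k : ℕ) (i : Fin k) : Cartan k :=
  if i.val + 1 < k then hvec k (i.val + 1) - hvec k (i.val + 2)
  else hvec k 0 - hvec k 1 - hvec k 2 - hvec k 3

/-- The distinguished element `K_k = -3 h_0 + h_1 + … + h_k`. -/
def canonical (k : ℕ) : Cartan k :=
  (-3 : ℝ) • hvec k 0 + ∑ i ∈ Finset.Icc 1 k, hvec k i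

/-- The Lie algebra `𝔤_k`. -/
abbrev G (k : ℕ) : Type := ChevalleyAlgebra ℝ (root k) (coroot k)

/-- The image in `𝔤_k` of an element of `𝔥_k`. -/
noncomputable abbrev gh (k : ℕ) (x : Cartan k) : G k :=
  ChevalleyAlgebra.gen ℝ (root k) (coroot k) (.h x)

/-- The generator `e_i` of `𝔤_k`. -/
noncomputable abbrev ge (k : ℕ) (i : Fin k) : G k :=
  ChevalleyAlgebra.gen ℝ (root k) (coroot k) (.e i)

/-- The generator `f_i` of `𝔤_k`. -/
noncomputable abbrev gf (k : ℕ) (i : Fin k) : G k :=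
  ChevalleyAlgebra.gen ℝ (root k) (coroot k) (.f i)

/-- The Lie algebra over `K` with Chevalley generators `h_i, e_i, f_i` and the Chevalley-Serre
relations of the matrix of type `E_k`. For `k ≠ 9`, it is `𝔢_{k(k)}` when `K = ℝ`, and `𝔢_k` when
`K = ℂ`. -/
abbrev E (K : Type*) [Field K] (k : ℕ) : Type _ := Matrix.ToLieAlgebra K (cartanMatrix k)

/-- The image in `E K k` of a generator `h_i`, `e_i` or `f_i`. -/
noncomputable def egen (K : Type*) [Field K] (k : ℕ) (x : CartanMatrix.Generators (Fin k)) :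
    E K k :=
  LieSubmodule.Quotient.mk
    (N := CartanMatrix.Relations.toIdeal K (cartanMatrix k)) (FreeLieAlgebra.of K x)

/-- `E ℝ k` is a real form of `E ℂ k`, namely the standard split one: the real span of brackets
of Chevalley generators. -/
def IsStandardSplitForm (k : ℕ) : Prop :=
  ∃ Ψ : (ℂ ⊗[ℝ] E ℝ k) ≃ₗ⁅ℂ⁆ E ℂ k,
    ∀ x : CartanMatrix.Generators (Fin k), Ψ (1 ⊗ₜ[ℝ] egen ℝ k x) = egen ℂ k x

section

attribute [local instance] LieRing.ofAssociativeRing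

/-- `𝔤_k` is the trivial one-dimensional central extension of `E ℝ k`: it is the product of `E ℝ k`
with the one-dimensional abelian Lie algebra `ℝ`, which corresponds to the line through the central
element `K_k`, compatibly with the Chevalley generators. -/
def IsTrivialCentralExtension (k : ℕ) : Prop :=
  ∃ Φ : G k ≃ₗ⁅ℝ⁆ (ℝ × E ℝ k),
    Φ (gh k (canonical k)) = (1, 0) ∧
    ∀ i : Fin k,
      Φ (gh k (coroot k i)) = (0, egen ℝ k (.H i)) ∧
      Φ (ge k i) = (0, egen ℝ k (.E i)) ∧
      Φ (gf k i) = (0, egen ℝ k (.F i))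

end

end ESeries

/-!
The presentations are compared through their universal properties: matching generators that satisfy
each other's relations give mutually inverse homomorphisms, which handles the extension of scalars
and every change of the Cartan space. The vector `K_k` is orthogonal to all coroots, and
`(K_k, K_k) = k - 9`. For `k ≠ 9` this splits it off the Cartan space as a central direct factor,
leaving the Serre presentation. For `k = 9` the matrix has corank one, so its realizations are
unique up to isomorphism.

For `k ≤ 8` the form is positive definite on the orthogonal complement of `K_k`, so the Cartan
matrix is positive definite. A quotient of a Verma-type module on words shows that the generators
`e_i` do not vanish. Simple reflections are realized by passing along `sl₂`-strings, and with them
any nonzero weight occurring in an ideal can be moved to a simple root. Hence the roots have norm 2,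
which leaves finitely many of them, and every nonzero ideal contains some `e_i`, which excludes
abelian ideals. For `k ≥ 9` the type of the matrix follows from its symmetry, by pairing `C v` with
a positive vector `u` such that `C u = 0` or `C u < 0`.
-/

/-! ### Lie algebras given by generators and relations -/

/-- The Lie algebra with generators `X` in which the elements `rels` of the free Lie algebra are set
to zero. `ChevalleyAlgebra` and `Matrix.ToLieAlgebra` are of this form. -/
abbrev PresentedLieAlgebra (K : Type*) {X : Type*} [CommRing K] (rels : Set (FreeLieAlgebra K X)) :
    Type _ :=
  FreeLieAlgebra K X ⧸ LieSubmodule.lieSpan K (FreeLieAlgebra K X) rels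

namespace PresentedLieAlgebra

variable {K X L : Type*} [CommRing K] [LieRing L] [LieAlgebra K L] (rels : Set (FreeLieAlgebra K X))

/-- The projection from the free Lie algebra. -/
noncomputable def mk : FreeLieAlgebra K X →ₗ⁅K⁆ PresentedLieAlgebra K rels where
  __ := (LieSubmodule.lieSpan K (FreeLieAlgebra K X) rels).toSubmodule.mkQ
  map_lie' := rfl

/-- The image of a generator. -/
noncomputable def of (x : X) : PresentedLieAlgebra K rels :=
  mk rels (FreeLieAlgebra.of K x)

variable {rels}

theorem mk_eq_zero {x : FreeLieAlgebra K X} (hx : x ∈ rels) : mk rels x = 0 :=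
  LieSubmodule.Quotient.mk_eq_zero'.2 (LieSubmodule.subset_lieSpan hx)

/-- The universal property of a presentation. -/
noncomputable def lift (g : X → L) (hg : ∀ x ∈ rels, FreeLieAlgebra.lift K g x = 0) :
    PresentedLieAlgebra K rels →ₗ⁅K⁆ L where
  __ := Submodule.liftQ (LieSubmodule.lieSpan K (FreeLieAlgebra K X) rels).toSubmodule
    (FreeLieAlgebra.lift K g : FreeLieAlgebra K X →ₗ[K] L) fun _ hx =>
      LieHom.mem_ker.1 (LieSubmodule.lieSpan_le.2 (fun y hy => LieHom.mem_ker.2 (hg y hy)) hx)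
  map_lie' {x y} := by
    induction x using Submodule.Quotient.induction_on
    induction y using Submodule.Quotient.induction_on
    exact LieHom.map_lie (FreeLieAlgebra.lift K g) _ _

theorem lift_of {g : X → L} (hg : ∀ x ∈ rels, FreeLieAlgebra.lift K g x = 0) (x : X) :
    lift g hg (of rels x) = g x :=
  FreeLieAlgebra.lift_of_apply g x

variable (rels) in
theorem lieSpan_range_of :
    LieSubalgebra.lieSpan K (PresentedLieAlgebra K rels) (Set.range (of rels)) = ⊤ := by
  set S := LieSubalgebra.lieSpan K (PresentedLieAlgebra K rels) (Set.range (of rels))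
  let g : X → S := fun x => ⟨of rels x, LieSubalgebra.subset_lieSpan ⟨x, rfl⟩⟩
  have mk_eq : mk rels = S.incl.comp (FreeLieAlgebra.lift K g) :=
    FreeLieAlgebra.hom_ext fun x => by simp [g, of]
  rw [eq_top_iff]
  intro y _
  obtain ⟨x, rfl⟩ := LieSubmodule.Quotient.surjective_mk' _ y
  change mk rels x ∈ S
  rw [mk_eq]
  exact (FreeLieAlgebra.lift K g x).2

end PresentedLieAlgebra

theorem lieHom_ext_of_lieSpan_eq_top {K L L' : Type*} [CommRing K] [LieRing L] [LieAlgebra K L]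
    [LieRing L'] [LieAlgebra K L'] {s : Set L} (hs : LieSubalgebra.lieSpan K L s = ⊤)
    {F G : L →ₗ⁅K⁆ L'} (h : ∀ x ∈ s, F x = G x) : F = G := by
  ext x
  have hx : x ∈ LieSubalgebra.lieSpan K L s := hs ▸ LieSubalgebra.mem_top x
  induction hx using LieSubalgebra.lieSpan_induction with
  | mem y hy => exact h y hy
  | zero => simp only [map_zero]
  | add u v _ _ hu hv => simp only [map_add, hu, hv]
  | smul t u _ hu => simp only [map_smul, hu]
  | lie u v _ _ hu hv => simp only [LieHom.map_lie, hu, hv]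

theorem lieHom_map_iterate_lie {K L L' : Type*} [CommRing K] [LieRing L] [LieAlgebra K L]
    [LieRing L'] [LieAlgebra K L'] (F : L →ₗ⁅K⁆ L') (n : ℕ) (x y : L) :
    F ((⁅x, ·⁆)^[n] y) = (⁅F x, ·⁆)^[n] (F y) :=
  Function.Semiconj.iterate_right (f := F) (ga := (⁅x, ·⁆)) (gb := (⁅F x, ·⁆))
    (fun z => F.map_lie x z) n y

theorem ad_pow_apply_eq_iterate {K L : Type*} [CommRing K] [LieRing L] [LieAlgebra K L]
    (n : ℕ) (x y : L) : (LieAlgebra.ad K L x ^ n) y = (⁅x, ·⁆)^[n] y :=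
  Module.End.pow_apply ..

/-- The isomorphism of Lie algebras given by two mutually inverse morphisms. -/
def lieEquivOfInverse {K L L' : Type*} [CommRing K] [LieRing L] [LieAlgebra K L] [LieRing L']
    [LieAlgebra K L'] (F : L →ₗ⁅K⁆ L') (G : L' →ₗ⁅K⁆ L) (hGF : G.comp F = LieHom.id)
    (hFG : F.comp G = LieHom.id) : L ≃ₗ⁅K⁆ L' where
  __ := F
  invFun := G
  left_inv := LieHom.congr_fun hGF
  right_inv := LieHom.congr_fun hFG

/-! ### The universal property of the Chevalley presentation -/

section Chevalley

variable (K : Type*) {V ι L : Type*} [Field K] [AddCommGroup V] [Module K V]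
  [LieRing L] [LieAlgebra K L]

/-- The linear map `h` and the elements `e i`, `f i` of `L` satisfy the defining relations of
`ChevalleyAlgebra K α αv`. The powers of `ad (e i)` are written as iterates of the bracket, so that
the relations do not mention the scalars of `L`. -/
structure IsChevalleyFamily (α : ι → Module.Dual K V) (αv : ι → V) (h : V →ₗ[K] L) (e f : ι → L) :
    Prop where
  hh : ∀ x y, ⁅h x, h y⁆ = 0
  he : ∀ x i, ⁅h x, e i⁆ = α i x • e i
  hf : ∀ x i, ⁅h x, f i⁆ = -(α i x • f i)
  ef_same : ∀ i, ⁅e i, f i⁆ = h (αv i)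
  ef_ne : ∀ i j, i ≠ j → ⁅e i, f j⁆ = 0
  serre_e : ∀ i j, i ≠ j → ∀ n : ℕ, (n : K) = 1 - α j (αv i) → (⁅e i, ·⁆)^[n] (e j) = 0
  serre_f : ∀ i j, i ≠ j → ∀ n : ℕ, (n : K) = 1 - α j (αv i) → (⁅f i, ·⁆)^[n] (f j) = 0

variable {K}

/-- The map on generators given by its values on the three kinds of generators. -/
def ChevalleyGenerator.elim (h : V → L) (e f : ι → L) : ChevalleyGenerator V ι → L
  | .h x => h x
  | .e i => e i
  | .f i => f i

namespace ChevalleyAlgebra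

variable (α : ι → Module.Dual K V) (αv : ι → V)

/-- The projection from the free Lie algebra. -/
noncomputable def mk : FreeLieAlgebra K (ChevalleyGenerator V ι) →ₗ⁅K⁆ ChevalleyAlgebra K α αv :=
  PresentedLieAlgebra.mk {x | ChevalleyRelator K α αv x}

variable {α αv} in
theorem mk_eq_zero {x : FreeLieAlgebra K (ChevalleyGenerator V ι)}
    (hx : ChevalleyRelator K α αv x) : mk α αv x = 0 :=
  PresentedLieAlgebra.mk_eq_zero hx

/-- The linear map from the Cartan space to the Lie algebra. -/
noncomputable def genH : V →ₗ[K] ChevalleyAlgebra K α αv where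
  toFun x := gen K α αv (.h x)
  map_add' x y := by
    have := mk_eq_zero (ChevalleyRelator.add (K := K) (α := α) (αv := αv) x y)
    rwa [map_sub, map_add, sub_eq_zero] at this
  map_smul' c x := by
    have := mk_eq_zero (ChevalleyRelator.smul (K := K) (α := α) (αv := αv) c x)
    rwa [map_sub, map_smul, sub_eq_zero] at this

theorem genH_apply (x : V) : genH α αv x = gen K α αv (.h x) := rfl

theorem isChevalleyFamily_gen :
    IsChevalleyFamily K α αv (genH α αv) (fun i => gen K α αv (.e i))
      (fun i => gen K α αv (.f i)) where
  hh x y := by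
    have := mk_eq_zero (ChevalleyRelator.hh (K := K) (α := α) (αv := αv) x y)
    rwa [LieHom.map_lie] at this
  he x i := by
    have := mk_eq_zero (ChevalleyRelator.he (K := K) (α := α) (αv := αv) x i)
    rwa [map_sub, map_smul, LieHom.map_lie, sub_eq_zero] at this
  hf x i := by
    have := mk_eq_zero (ChevalleyRelator.hf (K := K) (α := α) (αv := αv) x i)
    rwa [map_add, map_smul, LieHom.map_lie, add_eq_zero_iff_eq_neg] at this
  ef_same i := by
    have := mk_eq_zero (ChevalleyRelator.ef_same (K := K) (α := α) (αv := αv) i)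
    rwa [map_sub, LieHom.map_lie, sub_eq_zero] at this
  ef_ne i j hij := by
    have := mk_eq_zero (ChevalleyRelator.ef_ne (K := K) (α := α) (αv := αv) i j hij)
    rwa [LieHom.map_lie] at this
  serre_e i j hij n hn := by
    have := mk_eq_zero (ChevalleyRelator.serre_e (K := K) (α := α) (αv := αv) i j hij n hn)
    rwa [ad_pow_apply_eq_iterate, lieHom_map_iterate_lie] at this
  serre_f i j hij n hn := by
    have := mk_eq_zero (ChevalleyRelator.serre_f (K := K) (α := α) (αv := αv) i j hij n hn)
    rwa [ad_pow_apply_eq_iterate, lieHom_map_iterate_lie] at this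

theorem lieSpan_range_gen :
    LieSubalgebra.lieSpan K (ChevalleyAlgebra K α αv) (Set.range (gen K α αv)) = ⊤ :=
  PresentedLieAlgebra.lieSpan_range_of {x | ChevalleyRelator K α αv x}

variable {α αv} {h : V →ₗ[K] L} {e f : ι → L}

/-- The morphism of Lie algebras given by a Chevalley family. -/
noncomputable def lift (H : IsChevalleyFamily K α αv h e f) : ChevalleyAlgebra K α αv →ₗ⁅K⁆ L :=
  PresentedLieAlgebra.lift (rels := {x | ChevalleyRelator K α αv x})
    (ChevalleyGenerator.elim h e f) <| by
    rintro _ (⟨x, y⟩ | ⟨c, x⟩ | ⟨x, y⟩ | ⟨x, i⟩ | ⟨x, i⟩ | i | ⟨i, j, hij⟩ | ⟨i, j, hij, n, hn⟩ |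
      ⟨i, j, hij, n, hn⟩)
    · simp [ChevalleyGenerator.elim]
    · simp [ChevalleyGenerator.elim]
    · simpa [ChevalleyGenerator.elim] using H.hh x y
    · simpa [ChevalleyGenerator.elim, sub_eq_zero] using H.he x i
    · simp [ChevalleyGenerator.elim, H.hf x i]
    · simpa [ChevalleyGenerator.elim, sub_eq_zero] using H.ef_same i
    · simpa [ChevalleyGenerator.elim] using H.ef_ne i j hij
    · simpa [ad_pow_apply_eq_iterate, lieHom_map_iterate_lie, ChevalleyGenerator.elim]
        using H.serre_e i j hij n hn
    · simpa [ad_pow_apply_eq_iterate, lieHom_map_iterate_lie, ChevalleyGenerator.elim]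
        using H.serre_f i j hij n hn

@[simp]
theorem lift_h (H : IsChevalleyFamily K α αv h e f) (x : V) :
    lift H (gen K α αv (.h x)) = h x :=
  PresentedLieAlgebra.lift_of ..

@[simp]
theorem lift_e (H : IsChevalleyFamily K α αv h e f) (i : ι) :
    lift H (gen K α αv (.e i)) = e i :=
  PresentedLieAlgebra.lift_of ..

@[simp]
theorem lift_f (H : IsChevalleyFamily K α αv h e f) (i : ι) :
    lift H (gen K α αv (.f i)) = f i :=
  PresentedLieAlgebra.lift_of ..

theorem hom_ext {F G : ChevalleyAlgebra K α αv →ₗ⁅K⁆ L}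
    (hh : (F : ChevalleyAlgebra K α αv →ₗ[K] L) ∘ₗ genH α αv = G ∘ₗ genH α αv)
    (he : ∀ i, F (gen K α αv (.e i)) = G (gen K α αv (.e i)))
    (hf : ∀ i, F (gen K α αv (.f i)) = G (gen K α αv (.f i))) : F = G := by
  refine lieHom_ext_of_lieSpan_eq_top (lieSpan_range_gen α αv) ?_
  rintro _ ⟨x | i | i, rfl⟩
  exacts [LinearMap.congr_fun hh x, he i, hf i]

theorem lie_genH_eq_zero {x : V} (hx : ∀ i, α i x = 0) (y : ChevalleyAlgebra K α αv) :
    ⁅genH α αv x, y⁆ = 0 := by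
  have H := isChevalleyFamily_gen α αv
  have hy : y ∈ LieSubalgebra.lieSpan K (ChevalleyAlgebra K α αv) (Set.range (gen K α αv)) :=
    lieSpan_range_gen α αv ▸ LieSubalgebra.mem_top y
  induction hy using LieSubalgebra.lieSpan_induction with
  | mem y hy =>
    obtain ⟨x' | i | i, rfl⟩ := hy
    · exact H.hh x x'
    · rw [H.he, hx, zero_smul]
    · rw [H.hf, hx, zero_smul, neg_zero]
  | zero => exact lie_zero _
  | add u v _ _ hu hv => rw [lie_add, hu, hv, add_zero]
  | smul t u _ hu => rw [lie_smul, hu, smul_zero]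
  | lie u v _ _ hu hv => rw [leibniz_lie, hu, hv, zero_lie, lie_zero, add_zero]

end ChevalleyAlgebra

end Chevalley

/-! ### The universal property of the Serre presentation -/

section Serre

variable {ι L : Type*} [LieRing L]

/-- The element `ad (x i) ^ (1 - A i j) (x j)` occurring in the Serre relations. For `i = j` it is
`0`. -/
def serreElement (A : Matrix ι ι ℤ) (x : ι → L) (i j : ι) : L :=
  (⁅x i, ·⁆)^[(-A i j).toNat] ⁅x i, x j⁆

theorem serreElement_self (A : Matrix ι ι ℤ) (x : ι → L) (i : ι) : serreElement A x i i = 0 := by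
  rw [serreElement, lie_self, Function.iterate_fixed (lie_zero _)]

/-- The elements `h i`, `e i`, `f i` satisfy the relations of the contragredient Lie algebra of `A`:
all defining relations of `Matrix.ToLieAlgebra K A` except for the Serre relations. As `A` is
integral, the relations do not mention the scalars of `L`. -/
structure IsWeakSerreFamily (A : Matrix ι ι ℤ) (h e f : ι → L) : Prop where
  hh : ∀ i j, ⁅h i, h j⁆ = 0
  he : ∀ i j, ⁅h i, e j⁆ = A i j • e j
  hf : ∀ i j, ⁅h i, f j⁆ = -(A i j • f j)
  ef_same : ∀ i, ⁅e i, f i⁆ = h i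
  ef_ne : ∀ i j, i ≠ j → ⁅e i, f j⁆ = 0

/-- The elements `h i`, `e i`, `f i` satisfy the defining relations of `Matrix.ToLieAlgebra K A`. -/
structure IsSerreFamily (A : Matrix ι ι ℤ) (h e f : ι → L) : Prop
    extends IsWeakSerreFamily A h e f where
  serre_e : ∀ i j, serreElement A e i j = 0
  serre_f : ∀ i j, serreElement A f i j = 0

section Map

variable {K L' : Type*} [CommRing K] [LieAlgebra K L] [LieRing L'] [LieAlgebra K L']
  {A : Matrix ι ι ℤ} {h e f : ι → L}

theorem map_serreElement (F : L →ₗ⁅K⁆ L') (x : ι → L) (i j : ι) :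
    F (serreElement A x i j) = serreElement A (F ∘ x) i j := by
  rw [serreElement, lieHom_map_iterate_lie, LieHom.map_lie]
  rfl

theorem IsWeakSerreFamily.map (S : IsWeakSerreFamily A h e f) (F : L →ₗ⁅K⁆ L') :
    IsWeakSerreFamily A (F ∘ h) (F ∘ e) (F ∘ f) where
  hh i j := by simp [← LieHom.map_lie, S.hh]
  he i j := by simp [← LieHom.map_lie, S.he]
  hf i j := by simp [← LieHom.map_lie, S.hf]
  ef_same i := by simp [← LieHom.map_lie, S.ef_same]
  ef_ne i j hij := by simp [← LieHom.map_lie, S.ef_ne i j hij]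

theorem IsSerreFamily.map (S : IsSerreFamily A h e f) (F : L →ₗ⁅K⁆ L') :
    IsSerreFamily A (F ∘ h) (F ∘ e) (F ∘ f) where
  toIsWeakSerreFamily := S.toIsWeakSerreFamily.map F
  serre_e i j := by rw [← map_serreElement, S.serre_e, map_zero]
  serre_f i j := by rw [← map_serreElement, S.serre_f, map_zero]

end Map

/-- The map on generators given by its values on the three kinds of generators. -/
def serreElim (h e f : ι → L) : CartanMatrix.Generators ι → L
  | .H i => h i
  | .E i => e i
  | .F i => f i

section Lift

open CartanMatrix (Generators)
open CartanMatrix.Relations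

variable (K : Type*) [CommRing K] (A : Matrix ι ι ℤ) [DecidableEq ι]

/-- The projection from the free Lie algebra to the Serre presentation. -/
noncomputable def serreMk : FreeLieAlgebra K (Generators ι) →ₗ⁅K⁆ Matrix.ToLieAlgebra K A :=
  PresentedLieAlgebra.mk (toSet K A)

/-- The image in the Serre presentation of a generator. -/
noncomputable def serreGen (x : Generators ι) : Matrix.ToLieAlgebra K A :=
  serreMk K A (FreeLieAlgebra.of K x)

variable {K A} in
theorem serreMk_eq_zero {x : FreeLieAlgebra K (Generators ι)} (hx : x ∈ toSet K A) :
    serreMk K A x = 0 :=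
  PresentedLieAlgebra.mk_eq_zero hx

theorem isSerreFamily_serreGen :
    IsSerreFamily A (serreGen K A ∘ .H) (serreGen K A ∘ .E) (serreGen K A ∘ .F) where
  hh i j := by
    have := serreMk_eq_zero (A := A) (x := HH K (i, j)) (by simp [toSet])
    simpa [serreGen, HH] using this
  he i j := by
    have := serreMk_eq_zero (A := A) (x := HE K A (i, j)) (by simp [toSet])
    simpa [serreGen, HE, sub_eq_zero] using this
  hf i j := by
    have := serreMk_eq_zero (A := A) (x := HF K A (i, j)) (by simp [toSet])
    simpa [serreGen, HF, add_eq_zero_iff_eq_neg] using this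
  ef_same i := by
    have := serreMk_eq_zero (A := A) (x := EF K (i, i)) (by simp [toSet])
    simpa [serreGen, EF, sub_eq_zero] using this
  ef_ne i j hij := by
    have := serreMk_eq_zero (A := A) (x := EF K (i, j)) (by simp [toSet])
    simpa [serreGen, EF, hij] using this
  serre_e i j := by
    have := serreMk_eq_zero (A := A) (x := adE K A (i, j)) (by simp [toSet])
    simpa [serreElement, serreGen, adE, ad_pow_apply_eq_iterate, lieHom_map_iterate_lie] using this
  serre_f i j := by
    have := serreMk_eq_zero (A := A) (x := adF K A (i, j)) (by simp [toSet])
    simpa [serreElement, serreGen, adF, ad_pow_apply_eq_iterate, lieHom_map_iterate_lie] using this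

theorem lieSpan_range_serreGen :
    LieSubalgebra.lieSpan K (Matrix.ToLieAlgebra K A) (Set.range (serreGen K A)) = ⊤ :=
  PresentedLieAlgebra.lieSpan_range_of (toSet K A)

variable {K A} [LieAlgebra K L] {h e f : ι → L}

variable (K) in
/-- The morphism of Lie algebras given by a Serre family. -/
noncomputable def IsSerreFamily.lift (S : IsSerreFamily A h e f) :
    Matrix.ToLieAlgebra K A →ₗ⁅K⁆ L :=
  PresentedLieAlgebra.lift (rels := toSet K A) (serreElim h e f) <| by
    rintro _ (((((⟨⟨i, j⟩, rfl⟩ | ⟨⟨i, j⟩, rfl⟩) | ⟨⟨i, j⟩, rfl⟩) | ⟨⟨i, j⟩, rfl⟩) |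
      ⟨⟨i, j⟩, rfl⟩) | ⟨⟨i, j⟩, rfl⟩)
    · simpa [HH, serreElim] using S.hh i j
    · rcases eq_or_ne i j with rfl | hij
      · simpa [EF, serreElim, sub_eq_zero] using S.ef_same i
      · simpa [EF, serreElim, hij] using S.ef_ne i j hij
    · simpa [HE, serreElim, sub_eq_zero] using S.he i j
    · simp [HF, serreElim, S.hf i j]
    · simpa [adE, serreElim, ad_pow_apply_eq_iterate, lieHom_map_iterate_lie]
        using! S.serre_e i j
    · simpa [adF, serreElim, ad_pow_apply_eq_iterate, lieHom_map_iterate_lie]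
        using! S.serre_f i j

@[simp]
theorem IsSerreFamily.lift_serreGen (S : IsSerreFamily A h e f) (x : Generators ι) :
    S.lift K (serreGen K A x) = serreElim h e f x :=
  PresentedLieAlgebra.lift_of ..

theorem serre_hom_ext {F G : Matrix.ToLieAlgebra K A →ₗ⁅K⁆ L}
    (hFG : ∀ x, F (serreGen K A x) = G (serreGen K A x)) : F = G :=
  lieHom_ext_of_lieSpan_eq_top (lieSpan_range_serreGen K A) (by rintro _ ⟨x, rfl⟩; exact hFG x)

end Lift

end Serre

/-! ### Extension of scalars -/

section BaseChange

variable {R A L L' : Type*} [Field R] [Field A] [Algebra R A] [LieRing L] [LieAlgebra R L]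
  [LieRing L'] [LieAlgebra A L']

/-- The Lie algebra over `R` obtained from one over an extension `A` by restriction of scalars. -/
abbrev lieAlgebraOfExtension (R A L' : Type*) [Field R] [Field A] [Algebra R A] [LieRing L']
    [LieAlgebra A L'] : LieAlgebra R L' where
  __ := Module.compHom L' (algebraMap R A)
  lie_smul t x y := lie_smul (algebraMap R A t) x y

/-- The `A`-linear extension of a morphism of Lie algebras over `R` to the extension of scalars. -/
noncomputable def lieLiftBaseChange (A : Type*) [Field A] [Algebra R A] [LieAlgebra A L']
    [LieAlgebra R L'] [IsScalarTower R A L'] (F : L →ₗ⁅R⁆ L') : A ⊗[R] L →ₗ⁅A⁆ L' where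
  __ := (F : L →ₗ[R] L').liftBaseChange A
  map_lie' {x y} := by
    change (F : L →ₗ[R] L').liftBaseChange A ⁅x, y⁆ =
      ⁅(F : L →ₗ[R] L').liftBaseChange A x, (F : L →ₗ[R] L').liftBaseChange A y⁆
    induction x with
    | zero => simp only [zero_lie, map_zero]
    | add x₁ x₂ h₁ h₂ => simp only [add_lie, map_add, h₁, h₂]
    | tmul a x =>
      induction y with
      | zero => simp only [lie_zero, map_zero]
      | add y₁ y₂ h₁ h₂ => simp only [lie_add, map_add, h₁, h₂]
      | tmul b y => simp [mul_smul, smul_comm a b]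

theorem lieLiftBaseChange_one_tmul [LieAlgebra R L'] [IsScalarTower R A L'] (F : L →ₗ⁅R⁆ L')
    (x : L) : lieLiftBaseChange A F (1 ⊗ₜ x) = F x :=
  (LinearMap.liftBaseChange_tmul A (F : L →ₗ[R] L') 1 x).trans (one_smul A (F x))

variable (R A L) in
/-- The morphism `x ↦ 1 ⊗ x` to the extension of scalars. -/
noncomputable def lieIncludeRight : L →ₗ⁅R⁆ A ⊗[R] L where
  __ := TensorProduct.mk R A L 1
  map_lie' := by simp

theorem lieHom_baseChange_ext {s : Set L} (hs : LieSubalgebra.lieSpan R L s = ⊤)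
    {F G : A ⊗[R] L →ₗ⁅A⁆ L'} (h : ∀ x ∈ s, F (1 ⊗ₜ x) = G (1 ⊗ₜ x)) : F = G := by
  let _ : LieAlgebra R L' := lieAlgebraOfExtension R A L'
  have : IsScalarTower R A L' := .of_compHom R A L'
  let res (F : A ⊗[R] L →ₗ⁅A⁆ L') : L →ₗ⁅R⁆ L' :=
    { (F : A ⊗[R] L →ₗ[A] L').restrictScalars R ∘ₗ TensorProduct.mk R A L 1 with
      map_lie' := by simp [← LieHom.map_lie] }
  have res_eq : res F = res G := lieHom_ext_of_lieSpan_eq_top hs h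
  have linear_eq : (F : A ⊗[R] L →ₗ[A] L') = G :=
    TensorProduct.AlgebraTensorModule.curry_injective <| LinearMap.ext_ring <|
      LinearMap.ext (LieHom.congr_fun res_eq)
  exact LieHom.ext (LinearMap.congr_fun linear_eq)

end BaseChange

namespace IsChevalleyFamily

variable {ι R A V W L : Type*} [Field R] [AddCommGroup V] [Module R V] [AddCommGroup W]
  [LieRing L] {α : ι → Module.Dual R V} {αv : ι → V} {e f : ι → L}

theorem comp_linearMap [Module R W] [LieAlgebra R L] {β : ι → Module.Dual R W} {βv : ι → W}
    {h : W →ₗ[R] L} (H : IsChevalleyFamily R β βv h e f) (φ : V →ₗ[R] W)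
    (hα : ∀ i x, β i (φ x) = α i x) (hv : ∀ i, φ (αv i) = βv i) :
    IsChevalleyFamily R α αv (h ∘ₗ φ) e f where
  hh x y := by simp [H.hh]
  he x i := by simp [H.he, hα]
  hf x i := by simp [H.hf, hα]
  ef_same i := by simp [H.ef_same, hv]
  ef_ne := H.ef_ne
  serre_e i j hij n hn := H.serre_e i j hij n (by rw [hn, ← hv, hα])
  serre_f i j hij n hn := H.serre_f i j hij n (by rw [hn, ← hv, hα])

theorem baseChange [LieAlgebra R L] {h : V →ₗ[R] L} (H : IsChevalleyFamily R α αv h e f)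
    (A : Type*) [Field A] [Algebra R A] :
    IsChevalleyFamily A (fun i => (α i).baseChange A) (fun i => (1 : A) ⊗ₜ[R] αv i)
      (h.baseChange A) (fun i => 1 ⊗ₜ e i) (fun i => 1 ⊗ₜ f i) where
  hh x y := by
    induction x with
    | zero => simp only [map_zero, zero_lie]
    | add x₁ x₂ h₁ h₂ => simp only [add_lie, map_add, h₁, h₂, add_zero]
    | tmul a x =>
      induction y with
      | zero => simp only [map_zero, lie_zero]
      | add y₁ y₂ h₁ h₂ => simp only [lie_add, map_add, h₁, h₂, add_zero]
      | tmul b y => simp [H.hh]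
  he x i := by
    induction x with
    | zero => simp
    | add x₁ x₂ h₁ h₂ => simp only [add_lie, map_add, h₁, h₂, add_smul]
    | tmul a x => simp [H.he, TensorProduct.smul_tmul']
  hf x i := by
    induction x with
    | zero => simp
    | add x₁ x₂ h₁ h₂ => simp only [add_lie, map_add, h₁, h₂, add_smul, neg_add]
    | tmul a x => simp [H.hf, TensorProduct.smul_tmul', TensorProduct.tmul_neg]
  ef_same i := by simp [H.ef_same]
  ef_ne i j hij := by simp [H.ef_ne i j hij]
  serre_e i j hij n hn := by
    have hn' : (n : R) = 1 - α j (αv i) :=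
      (algebraMap R A).injective (by simpa [Algebra.smul_def] using hn)
    simpa only [H.serre_e i j hij n hn', map_zero]
      using! (lieHom_map_iterate_lie (lieIncludeRight R A L) n (e i) (e j)).symm
  serre_f i j hij n hn := by
    have hn' : (n : R) = 1 - α j (αv i) :=
      (algebraMap R A).injective (by simpa [Algebra.smul_def] using hn)
    simpa only [H.serre_f i j hij n hn', map_zero]
      using! (lieHom_map_iterate_lie (lieIncludeRight R A L) n (f i) (f j)).symm

theorem restrictScalars [Field A] [Algebra R A] [Module A W] [Module R W] [IsScalarTower R A W]
    [LieAlgebra A L] [LieAlgebra R L] [IsScalarTower R A L] {β : ι → Module.Dual A W} {βv : ι → W}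
    {h : W →ₗ[A] L} (H : IsChevalleyFamily A β βv h e f) (ψ : V →ₗ[R] W)
    (hα : ∀ i x, β i (ψ x) = algebraMap R A (α i x)) (hv : ∀ i, ψ (αv i) = βv i) :
    IsChevalleyFamily R α αv (h.restrictScalars R ∘ₗ ψ) e f where
  hh x y := by simp [H.hh]
  he x i := by simp [H.he, hα]
  hf x i := by simp [H.hf, hα]
  ef_same i := by simp [H.ef_same, hv]
  ef_ne := H.ef_ne
  serre_e i j hij n hn := H.serre_e i j hij n (by
    simpa [← hv, hα] using congrArg (algebraMap R A) hn)
  serre_f i j hij n hn := H.serre_f i j hij n (by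
    simpa [← hv, hα] using congrArg (algebraMap R A) hn)

end IsChevalleyFamily

namespace ChevalleyAlgebra

variable {ι R V W : Type*} [Field R] [AddCommGroup V] [Module R V] [AddCommGroup W]
  {α : ι → Module.Dual R V} {αv : ι → V}

theorem exists_equiv_of_linearEquiv [Module R W] {β : ι → Module.Dual R W} {βv : ι → W}
    (φ : V ≃ₗ[R] W) (hα : ∀ i x, β i (φ x) = α i x) (hv : ∀ i, φ (αv i) = βv i) :
    ∃ Φ : ChevalleyAlgebra R α αv ≃ₗ⁅R⁆ ChevalleyAlgebra R β βv,
      (∀ x, Φ (gen R α αv (.h x)) = gen R β βv (.h (φ x))) ∧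
      ∀ i, Φ (gen R α αv (.e i)) = gen R β βv (.e i) ∧
        Φ (gen R α αv (.f i)) = gen R β βv (.f i) := by
  have hF := (isChevalleyFamily_gen β βv).comp_linearMap (α := α) (αv := αv) φ.toLinearMap hα hv
  have hG := (isChevalleyFamily_gen α αv).comp_linearMap (α := β) (αv := βv) φ.symm.toLinearMap
    (fun i x => by simp [← hα]) (fun i => by simp [← hv])
  exact ⟨lieEquivOfInverse (lift hF) (lift hG)
      (hom_ext (by ext x; simp [genH_apply]) (by simp) (by simp))
      (hom_ext (by ext x; simp [genH_apply]) (by simp) (by simp)),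
    lift_h hF, fun i => ⟨lift_e hF i, lift_f hF i⟩⟩

theorem exists_baseChange_equiv {A : Type*} [Field A] [Algebra R A] [Module A W]
    {β : ι → Module.Dual A W} {βv : ι → W} (ψ : (A ⊗[R] V) ≃ₗ[A] W)
    (hα : ∀ i x, β i (ψ (1 ⊗ₜ x)) = algebraMap R A (α i x)) (hv : ∀ i, ψ (1 ⊗ₜ αv i) = βv i) :
    ∃ Ψ : (A ⊗[R] ChevalleyAlgebra R α αv) ≃ₗ⁅A⁆ ChevalleyAlgebra A β βv,
      (∀ x, Ψ (1 ⊗ₜ gen R α αv (.h x)) = gen A β βv (.h (ψ (1 ⊗ₜ x)))) ∧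
      ∀ i, Ψ (1 ⊗ₜ gen R α αv (.e i)) = gen A β βv (.e i) ∧
        Ψ (1 ⊗ₜ gen R α αv (.f i)) = gen A β βv (.f i) := by
  let _ : LieAlgebra R (ChevalleyAlgebra A β βv) := lieAlgebraOfExtension R A _
  have : IsScalarTower R A (ChevalleyAlgebra A β βv) := .of_compHom R A _
  let _ : Module R W := Module.compHom W (algebraMap R A)
  have : IsScalarTower R A W := .of_compHom R A W
  have root_symm i : (α i).baseChange A = β i ∘ₗ ψ := by
    ext x
    simp [hα, Algebra.smul_def]
  have hF := (isChevalleyFamily_gen β βv).restrictScalars (α := α) (αv := αv)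
    (ψ.toLinearMap.restrictScalars R ∘ₗ TensorProduct.mk R A V 1) hα hv
  have hG := ((isChevalleyFamily_gen α αv).baseChange A).comp_linearMap (α := β) (αv := βv)
    ψ.symm.toLinearMap (fun i w => by simp [root_symm]) (fun i => by simp [← hv])
  let F := lieLiftBaseChange A (lift hF)
  have F_h x : F (1 ⊗ₜ genH α αv x) = genH β βv (ψ (1 ⊗ₜ x)) :=
    (lieLiftBaseChange_one_tmul ..).trans (lift_h ..)
  have F_e i : F (1 ⊗ₜ gen R α αv (.e i)) = gen A β βv (.e i) :=
    (lieLiftBaseChange_one_tmul ..).trans (lift_e ..)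
  have F_f i : F (1 ⊗ₜ gen R α αv (.f i)) = gen A β βv (.f i) :=
    (lieLiftBaseChange_one_tmul ..).trans (lift_f ..)
  have G_h x : lift hG (genH β βv x) = (genH α αv).baseChange A (ψ.symm x) := lift_h hG x
  refine ⟨lieEquivOfInverse F (lift hG) (lieHom_baseChange_ext (lieSpan_range_gen α αv) ?_)
    (hom_ext (LinearMap.ext fun w => ?_) ?_ ?_), F_h, fun i => ⟨F_e i, F_f i⟩⟩
  · rintro _ ⟨x | i | i, rfl⟩
    · simp [← genH_apply, F_h, G_h]
    · simp [F_e]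
    · simp [F_f]
  · obtain ⟨x, rfl⟩ := ψ.surjective w
    have cartan_eq : (F : _ →ₗ[A] _) ∘ₗ (genH α αv).baseChange A = genH β βv ∘ₗ ψ := by
      ext x
      simp [F_h]
    simpa [G_h] using LinearMap.congr_fun cartan_eq x
  · simp [F_e]
  · simp [F_f]

end ChevalleyAlgebra

section Serre

variable {ι : Type*} [DecidableEq ι]

theorem exists_serre_baseChange_equiv (R K : Type*) [Field R] [Field K] [Algebra R K]
    (A : Matrix ι ι ℤ) :
    ∃ Ψ : (K ⊗[R] Matrix.ToLieAlgebra R A) ≃ₗ⁅K⁆ Matrix.ToLieAlgebra K A,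
      ∀ x, Ψ (1 ⊗ₜ serreGen R A x) = serreGen K A x := by
  let _ : LieAlgebra R (Matrix.ToLieAlgebra K A) := lieAlgebraOfExtension R K _
  have : IsScalarTower R K (Matrix.ToLieAlgebra K A) := .of_compHom R K _
  let F := lieLiftBaseChange K ((isSerreFamily_serreGen K A).lift R)
  let G := ((isSerreFamily_serreGen R A).map (lieIncludeRight R K _)).lift K
  have hF x : F (1 ⊗ₜ serreGen R A x) = serreGen K A x := by
    rw [lieLiftBaseChange_one_tmul, IsSerreFamily.lift_serreGen]
    cases x <;> rfl
  have hG x : G (serreGen K A x) = 1 ⊗ₜ serreGen R A x := by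
    rw [IsSerreFamily.lift_serreGen]
    cases x <;> rfl
  refine ⟨lieEquivOfInverse F G (lieHom_baseChange_ext (lieSpan_range_serreGen R A) ?_)
    (serre_hom_ext fun x => ?_), hF⟩
  · rintro _ ⟨x, rfl⟩
    rw [LieHom.comp_apply, hF, hG, LieHom.id_apply]
  · rw [LieHom.comp_apply, hG, hF, LieHom.id_apply]

end Serre

theorem ESeries.isStandardSplitForm (k : ℕ) : ESeries.IsStandardSplitForm k :=
  exists_serre_baseChange_equiv ℝ ℂ (ESeries.cartanMatrix k)

/-! ### Roots and coroots of type `E_k` -/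

namespace ESeries

variable {k : ℕ}

/-- The `n`-th coordinate on `𝔥_k`, taken to be zero for `n > k`, so that identities between
coordinates need no proofs of `n ≤ k`. -/
noncomputable def coord (k n : ℕ) : Module.Dual ℝ (Cartan k) :=
  if h : n < k + 1 then LinearMap.proj ⟨n, h⟩ else 0

theorem coord_fin (i : Fin (k + 1)) (x : Cartan k) : coord k i x = x i := by
  simp [coord, i.2]

theorem coord_hvec (n j : ℕ) : coord k n (hvec k j) = if n = j ∧ n ≤ k then 1 else 0 := by
  by_cases h : n < k + 1 <;> simp [coord, hvec, h, Nat.lt_succ_iff.symm]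

theorem ext_coord {x y : Cartan k} (h : ∀ n ≤ k, coord k n x = coord k n y) : x = y :=
  funext fun i => by simpa only [coord_fin] using h i (Nat.le_of_lt_succ i.2)

theorem minkowski_apply (x y : Cartan k) :
    minkowski k x y = (∑ n ∈ Finset.range k, coord k (n + 1) x * coord k (n + 1) y) -
      coord k 0 x * coord k 0 y := by
  have h0 (z : Cartan k) : coord k 0 z = z 0 := coord_fin 0 z
  have hs (z : Cartan k) (i : Fin k) : coord k (i + 1) z = z i.succ := coord_fin i.succ z
  simp only [minkowski, Matrix.toBilin'_apply', Matrix.mulVec_diagonal, dotProduct,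
    Fin.sum_univ_succ, Finset.sum_range, h0, hs, if_true, Fin.succ_ne_zero, if_false]
  ring_nf

theorem minkowski_comm (x y : Cartan k) : minkowski k x y = minkowski k y x := by
  simp only [minkowski_apply, mul_comm]

theorem minkowski_hvec (j : ℕ) (x : Cartan k) :
    minkowski k (hvec k j) x = (if j = 0 then -1 else 1) * coord k j x := by
  rw [minkowski_apply]
  rcases j with _ | j
  · simp [coord_hvec]
  · by_cases hj : j < k
    · rw [Finset.sum_eq_single j (by simp +contextual [coord_hvec]) (by simp [hj])]
      simp [coord_hvec, Nat.succ_le_of_lt hj]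
    · have hx : coord k (j + 1) x = 0 := by simp [coord, hj]
      rw [Finset.sum_eq_zero fun n hn => ?_]
      · simp [coord_hvec, hx]
      · have := Finset.mem_range.1 hn
        rw [coord_hvec, if_neg (by omega), zero_mul]

theorem ker_minkowski : LinearMap.ker (minkowski k) = ⊥ := by
  refine LinearMap.ker_eq_bot'.2 fun x hx => ext_coord fun n _ => ?_
  have h := LinearMap.congr_fun hx (hvec k n)
  rw [minkowski_comm, minkowski_hvec] at h
  split_ifs at h <;> simpa using h

theorem root_apply (i : Fin k) (x : Cartan k) :
    root k i x = if i.val + 1 < k then coord k (i + 1) x - coord k (i + 2) x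
      else -coord k 0 x - coord k 1 x - coord k 2 x - coord k 3 x := by
  unfold root eps
  split_ifs <;> simp [minkowski_hvec]

theorem minkowski_coroot (i : Fin k) : minkowski k (coroot k i) = root k i := by
  unfold root coroot eps
  split_ifs <;> simp only [map_sub]

theorem cartanMatrix_symm (i j : Fin k) : cartanMatrix k i j = cartanMatrix k j i := by
  unfold cartanMatrix
  grind

theorem root_coroot (hk : 3 ≤ k) (i j : Fin k) :
    root k j (coroot k i) = (cartanMatrix k i j : ℝ) := by
  obtain ⟨i, hi⟩ := i
  obtain ⟨j, hj⟩ := j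
  rw [root_apply]
  simp only [coroot, cartanMatrix, Fin.mk.injEq]
  by_cases hi' : i + 1 < k <;> by_cases hj' : j + 1 < k <;>
    simp only [hi', hj', if_true, if_false, map_sub, coord_hvec, Int.cast_ite, Int.cast_neg,
      Int.cast_ofNat, Int.cast_one, Int.cast_zero] <;>
    grind

theorem coord_zero_canonical : coord k 0 (canonical k) = -3 := by
  simp [canonical, coord_hvec]

theorem coord_canonical {n : ℕ} (hn : 1 ≤ n) (hnk : n ≤ k) : coord k n (canonical k) = 1 := by
  simp [canonical, coord_hvec, hn, hnk, Nat.ne_of_gt hn]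

theorem root_canonical (hk : 3 ≤ k) (i : Fin k) : root k i (canonical k) = 0 := by
  rw [root_apply]
  split_ifs with h
  · rw [coord_canonical (by omega) (by omega), coord_canonical (by omega) (by omega), sub_self]
  · rw [coord_zero_canonical, coord_canonical (by omega) (by omega),
      coord_canonical (by omega) (by omega), coord_canonical (by omega) hk]
    norm_num

theorem minkowski_canonical (x : Cartan k) :
    minkowski k (canonical k) x = (∑ n ∈ Finset.range k, coord k (n + 1) x) + 3 * coord k 0 x := by
  rw [minkowski_apply, coord_zero_canonical, neg_mul, sub_neg_eq_add]
  congr 1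
  refine Finset.sum_congr rfl fun n hn => ?_
  rw [coord_canonical (Nat.le_add_left 1 n) (Finset.mem_range.1 hn), one_mul]

theorem minkowski_canonical_self : minkowski k (canonical k) (canonical k) = k - 9 := by
  rw [minkowski_canonical, coord_zero_canonical, Finset.sum_congr rfl fun n hn =>
    coord_canonical (Nat.le_add_left 1 n) (Finset.mem_range.1 hn)]
  simp
  ring

/-- The fundamental weights, dual to the simple coroots. The one at a node of the line is
`ε_1 + ⋯ + ε_i` plus the multiple of the `0`-th coordinate which makes it vanish on the last
coroot. -/
noncomputable def fundamentalWeight (k : ℕ) (i : Fin k) : Module.Dual ℝ (Cartan k) :=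
  if i.val + 1 < k then
    (∑ n ∈ Finset.range (i + 1), coord k (n + 1)) + (min (i + 1) 3 : ℕ) • coord k 0
  else coord k 0

theorem sum_coord_hvec {m : ℕ} (hm : m ≤ k) (j : ℕ) :
    ∑ n ∈ Finset.range m, coord k (n + 1) (hvec k j) = if 1 ≤ j ∧ j ≤ m then 1 else 0 := by
  rcases j with _ | j
  · simp [coord_hvec]
  · simp only [coord_hvec, add_left_inj]
    split_ifs with hj
    · rw [Finset.sum_eq_single j (by simp +contextual) (by simp; omega), if_pos (by omega)]
    · refine Finset.sum_eq_zero fun n hn => if_neg ?_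
      have := Finset.mem_range.1 hn
      omega

theorem fundamentalWeight_hvec (i : Fin k) (j : ℕ) :
    fundamentalWeight k i (hvec k j) = if i.val + 1 < k then
      if j = 0 then ((min (i + 1) 3 : ℕ) : ℝ) else if j ≤ i + 1 then 1 else 0
      else if j = 0 then 1 else 0 := by
  unfold fundamentalWeight
  by_cases hi : i.val + 1 < k
  · simp only [if_pos hi, LinearMap.add_apply, LinearMap.sum_apply, sum_coord_hvec hi.le,
      LinearMap.smul_apply]
    rcases j with _ | j <;> simp [coord_hvec]
  · simp [hi, coord_hvec, eq_comm]

theorem fundamentalWeight_coroot (hk : 3 ≤ k) (i j : Fin k) :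
    fundamentalWeight k i (coroot k j) = if i = j then 1 else 0 := by
  obtain ⟨i, hi⟩ := i
  obtain ⟨j, hj⟩ := j
  simp only [coroot, Fin.mk.injEq]
  by_cases hj' : j + 1 < k
  · simp only [if_pos hj', map_sub, fundamentalWeight_hvec]
    grind
  · have hi3 : i = 0 ∧ min (i + 1) 3 = 1 ∨ i = 1 ∧ min (i + 1) 3 = 2 ∨
        2 ≤ i ∧ min (i + 1) 3 = 3 := by omega
    simp only [if_neg hj', map_sub, fundamentalWeight_hvec]
    rcases hi3 with ⟨hi3, hmin⟩ | ⟨hi3, hmin⟩ | ⟨hi3, hmin⟩ <;>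
      simp only [hmin, Nat.cast_one, Nat.cast_ofNat] <;> grind

end ESeries

namespace ESeries

variable {k : ℕ}

/-- The linear combination of the simple coroots with given coefficients. -/
noncomputable def corootComb (k : ℕ) : (Fin k → ℝ) →ₗ[ℝ] Cartan k :=
  Fintype.linearCombination ℝ (coroot k)

theorem corootComb_apply (b : Fin k → ℝ) : corootComb k b = ∑ i, b i • coroot k i :=
  Fintype.linearCombination_apply ..

theorem fundamentalWeight_corootComb (hk : 3 ≤ k) (i : Fin k) (b : Fin k → ℝ) :
    fundamentalWeight k i (corootComb k b) = b i := by
  simp [corootComb_apply, fundamentalWeight_coroot hk]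

theorem corootComb_injective (hk : 3 ≤ k) : Function.Injective (corootComb k) := fun b c h =>
  funext fun i => by
    rw [← fundamentalWeight_corootComb hk i b, h, fundamentalWeight_corootComb hk]

theorem linearIndependent_coroot (hk : 3 ≤ k) : LinearIndependent ℝ (coroot k) :=
  linearIndependent_iff_injective_fintypeLinearCombination.2 (corootComb_injective hk)

theorem linearIndependent_root (hk : 3 ≤ k) : LinearIndependent ℝ (root k) := by
  simpa only [Function.comp_def, minkowski_coroot] using
    (linearIndependent_coroot hk).map' (minkowski k) ker_minkowski

theorem minkowski_canonical_corootComb (hk : 3 ≤ k) (b : Fin k → ℝ) :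
    minkowski k (canonical k) (corootComb k b) = 0 := by
  rw [minkowski_comm, corootComb_apply]
  simp [minkowski_coroot, root_canonical hk]

theorem exists_corootComb_eq (hk : 3 ≤ k) {x : Cartan k} (hx : minkowski k (canonical k) x = 0) :
    ∃ b, corootComb k b = x := by
  have hne : minkowski k (canonical k) ≠ 0 := fun h => by
    have := LinearMap.congr_fun h (hvec k 0)
    rw [minkowski_comm, minkowski_hvec, coord_zero_canonical] at this
    norm_num at this
  have hrange : LinearMap.range (corootComb k) = LinearMap.ker (minkowski k (canonical k)) := by
    refine Submodule.eq_of_le_of_finrank_eq ?_ ?_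
    · rintro _ ⟨b, rfl⟩
      exact minkowski_canonical_corootComb hk b
    · rw [LinearMap.finrank_range_of_inj (corootComb_injective hk)]
      simpa using (Module.Dual.finrank_ker_add_one_of_ne_zero hne).symm
  exact hrange.ge hx

theorem root_corootComb (hk : 3 ≤ k) (b : Fin k → ℝ) (i : Fin k) :
    root k i (corootComb k b) = ((cartanMatrix k).map (Int.cast : ℤ → ℝ)).mulVec b i := by
  simp only [corootComb_apply, map_sum, map_smul, root_coroot hk, smul_eq_mul, Matrix.mulVec,
    dotProduct, Matrix.map_apply, cartanMatrix_symm i, mul_comm]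

theorem minkowski_corootComb (hk : 3 ≤ k) (b c : Fin k → ℝ) :
    minkowski k (corootComb k b) (corootComb k c) =
      b ⬝ᵥ ((cartanMatrix k).map (Int.cast : ℤ → ℝ)).mulVec c := by
  rw [corootComb_apply b]
  simp [minkowski_coroot, root_corootComb hk, dotProduct]

theorem minkowski_self_pos (hk8 : k ≤ 8) {x : Cartan k} (hx : minkowski k (canonical k) x = 0)
    (hx0 : x ≠ 0) : 0 < minkowski k x x := by
  have hk' : (k : ℝ) ≤ 8 := mod_cast hk8
  rw [minkowski_canonical] at hx
  have hcs := sq_sum_le_card_mul_sum_sq (s := Finset.range k) (f := fun n => coord k (n + 1) x)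
  simp only [eq_neg_of_add_eq_zero_left hx, Finset.card_range] at hcs
  simp only [minkowski_apply, ← sq]
  set S := ∑ n ∈ Finset.range k, coord k (n + 1) x ^ 2 with hS
  have hterm : ∀ n ∈ Finset.range k, 0 ≤ coord k (n + 1) x ^ 2 := fun n _ => sq_nonneg _
  have hpos : 0 < S := by
    refine (Finset.sum_nonneg hterm).lt_of_ne' fun hS0 => hx0 (ext_coord fun n hn => ?_)
    have hsucc : ∀ n < k, coord k (n + 1) x = 0 := fun n hn =>
      pow_eq_zero_iff two_ne_zero |>.1
        ((Finset.sum_eq_zero_iff_of_nonneg hterm).1 hS0 n (Finset.mem_range.2 hn))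
    rw [map_zero]
    rcases n with _ | n
    · rw [Finset.sum_eq_zero fun n hn => hsucc n (Finset.mem_range.1 hn)] at hx
      linarith
    · exact hsucc n hn
  nlinarith

/-- `E_k` is of finite type for `k ≤ 8` because the canonical element is then timelike:
`(K_k, K_k) = k - 9`. -/
theorem posDef_cartanMatrix (hk : 3 ≤ k) (hk8 : k ≤ 8) :
    ((cartanMatrix k).map (Int.cast : ℤ → ℝ)).PosDef := by
  refine .of_dotProduct_mulVec_pos (Matrix.IsHermitian.ext fun i j => ?_) fun b hb => ?_
  · simp [cartanMatrix_symm i j]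
  · rw [star_trivial, ← minkowski_corootComb hk]
    exact minkowski_self_pos hk8 (minkowski_canonical_corootComb hk b)
      ((map_ne_zero_iff _ (corootComb_injective hk)).2 hb)

theorem exists_equiv_prod (hk : 3 ≤ k) (hk9 : k ≠ 9) :
    ∃ T : (ℝ × (Fin k → ℝ)) ≃ₗ[ℝ] Cartan k,
      ∀ a b, T (a, b) = a • canonical k + corootComb k b := by
  let T := (LinearMap.toSpanSingleton ℝ _ (canonical k)).coprod (corootComb k)
  have hT (a b) : T (a, b) = a • canonical k + corootComb k b := by simp [T]
  have hinj : Function.Injective T := by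
    refine (injective_iff_map_eq_zero T).2 fun ⟨a, b⟩ h => ?_
    rw [hT] at h
    have ha : a = 0 := by
      have := congrArg (minkowski k (canonical k)) h
      rw [map_add, map_smul, minkowski_canonical_self, minkowski_canonical_corootComb hk, add_zero,
        map_zero, smul_eq_mul] at this
      exact (mul_eq_zero.1 this).resolve_right (sub_ne_zero.2 (mod_cast hk9))
    rw [ha, zero_smul, zero_add] at h
    rw [ha, (map_eq_zero_iff _ (corootComb_injective hk)).1 h, Prod.mk_zero_zero]
  exact ⟨T.linearEquivOfInjective hinj (by simp [add_comm]), hT⟩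

end ESeries

/-! ### Affine and indefinite type -/

section SymmetricMatrix

variable {R ι : Type*} [CommRing R] [Fintype ι] {M : Matrix ι ι R} {u v : ι → R}

theorem dotProduct_mulVec_eq_of_isSymm (hM : M.IsSymm) : u ⬝ᵥ M.mulVec v = M.mulVec u ⬝ᵥ v := by
  rw [Matrix.dotProduct_mulVec, ← Matrix.mulVec_transpose, hM]

variable [LinearOrder R] [IsStrictOrderedRing R]

theorem mulVec_eq_zero_of_nonneg_of_isSymm (hM : M.IsSymm) (hu : ∀ i, 0 < u i)
    (hMu : M.mulVec u = 0) (hMv : ∀ i, 0 ≤ M.mulVec v i) : M.mulVec v = 0 := by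
  have h : ∑ i, u i * M.mulVec v i = 0 := by
    change u ⬝ᵥ _ = 0
    rw [dotProduct_mulVec_eq_of_isSymm hM, hMu, zero_dotProduct]
  funext i
  have hi := (Finset.sum_eq_zero_iff_of_nonneg fun i _ => mul_nonneg (hu i).le (hMv i)).1 h i
    (Finset.mem_univ i)
  exact (mul_eq_zero.1 hi).resolve_left (hu i).ne'

theorem eq_zero_of_nonneg_of_isSymm (hM : M.IsSymm) (hu : ∀ i, 0 < u i)
    (hMu : ∀ i, M.mulVec u i < 0) (hMv : ∀ i, 0 ≤ M.mulVec v i) (hv : ∀ i, 0 ≤ v i) : v = 0 := by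
  have hle (i : ι) : M.mulVec u i * v i ≤ 0 := mul_nonpos_of_nonpos_of_nonneg (hMu i).le (hv i)
  have h : ∑ i, M.mulVec u i * v i = 0 := by
    refine le_antisymm (Finset.sum_nonpos fun i _ => hle i) ?_
    change 0 ≤ _ ⬝ᵥ v
    rw [← dotProduct_mulVec_eq_of_isSymm hM]
    exact Finset.sum_nonneg fun i _ => mul_nonneg (hu i).le (hMv i)
  funext i
  have hi := (Finset.sum_eq_zero_iff_of_nonpos fun i _ => hle i).1 h i (Finset.mem_univ i)
  exact (mul_eq_zero.1 hi).resolve_left (hMu i).ne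

end SymmetricMatrix

namespace ESeries

variable {k : ℕ}

theorem isSymm_map_cartanMatrix {R : Type*} [Ring R] :
    ((cartanMatrix k).map (Int.cast : ℤ → R)).IsSymm :=
  Matrix.IsSymm.ext fun i j => by simp [cartanMatrix_symm i j]

theorem eq_of_forall_cartanMatrix_ne_zero (hk : 4 ≤ k) {P : Fin k → Prop}
    (hP : ∀ i j, cartanMatrix k i j ≠ 0 → (P i ↔ P j)) (i j : Fin k) : P i ↔ P j := by
  have hline (n : ℕ) (h : n + 1 < k) : P ⟨n, by omega⟩ ↔ P ⟨0, by omega⟩ := by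
    induction n with
    | zero => rfl
    | succ n ih =>
      refine (hP _ _ ?_).trans (ih (by omega))
      simp [cartanMatrix, h]
  have hall (i : Fin k) : P i ↔ P ⟨0, by omega⟩ := by
    by_cases h : i.val + 1 < k
    · exact hline i h
    · refine (hP _ _ ?_).trans (hline 2 (by omega))
      have hik : i.val + 1 = k := by omega
      simp [cartanMatrix, Fin.ext_iff, hik]
      omega
  rw [hall i, hall j]

theorem cartanMatrix_nonpos {i j : Fin k} (hij : i ≠ j) : cartanMatrix k i j ≤ 0 := by
  unfold cartanMatrix
  split_ifs <;> first | contradiction | norm_num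

theorem isIndecomposableGCM (hk : 4 ≤ k) : IsIndecomposableGCM (cartanMatrix k) where
  diag i := by simp [cartanMatrix]
  off_diag _ _ := cartanMatrix_nonpos
  zero i j h := by rw [cartanMatrix_symm, h]
  indecomposable := by
    rintro S ⟨i, hi⟩ ⟨j, hj⟩
    by_contra! hS
    refine hj ((eq_of_forall_cartanMatrix_ne_zero hk (P := (· ∈ S)) (fun i j hij => ?_) i j).1 hi)
    refine ⟨fun hi => ?_, fun hj => ?_⟩ <;> by_contra hn
    · exact hij (hS i hi j hn)
    · exact hij (by rw [cartanMatrix_symm, hS j hj i hn])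

/-- The marks of the affine diagram `E_9`, spanning the kernel of its Cartan matrix. -/
def mark : Fin 9 → ℤ := ![2, 4, 6, 5, 4, 3, 2, 1, 3]

theorem mark_pos (i : Fin 9) : 0 < mark i := by
  decide +revert

theorem cartanMatrix_mulVec_mark : (cartanMatrix 9).mulVec mark = 0 := by
  decide

section Affine

variable (K : Type*) [Field K]

theorem mulVec_mark :
    ((cartanMatrix 9).map (Int.cast : ℤ → K)).mulVec (fun i => (mark i : K)) = 0 := by
  funext i
  simpa [Matrix.mulVec, dotProduct] using
    congrArg (Int.cast : ℤ → K) (congrFun cartanMatrix_mulVec_mark i)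

variable [CharZero K]

theorem eq_smul_mark {v : Fin 9 → K}
    (hv : ((cartanMatrix 9).map (Int.cast : ℤ → K)).mulVec v = 0) :
    v = v 7 • fun i => (mark i : K) := by
  have e (i : Fin 9) : ∑ j, (cartanMatrix 9 i j : K) * v j = 0 := congrFun hv i
  obtain ⟨-, e1, e2, e3, e4, e5, e6, e7, e8⟩ : 2 * v 0 + -v 1 = 0 ∧
      -v 0 + (2 * v 1 + -v 2) = 0 ∧ -v 1 + (2 * v 2 + (-v 3 + -v 8)) = 0 ∧
      -v 2 + (2 * v 3 + -v 4) = 0 ∧ -v 3 + (2 * v 4 + -v 5) = 0 ∧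
      -v 4 + (2 * v 5 + -v 6) = 0 ∧ -v 5 + (2 * v 6 + -v 7) = 0 ∧ -v 6 + 2 * v 7 = 0 ∧
      -v 2 + 2 * v 8 = 0 := by
    simpa [cartanMatrix, Fin.forall_fin_succ, Fin.sum_univ_succ] using e
  have h6 : v 6 = v 7 * 2 := by linear_combination -e7
  have h5 : v 5 = v 7 * 3 := by linear_combination -e6 + 2 * h6
  have h4 : v 4 = v 7 * 4 := by linear_combination -e5 + 2 * h5 - h6
  have h3 : v 3 = v 7 * 5 := by linear_combination -e4 + 2 * h4 - h5
  have h2 : v 2 = v 7 * 6 := by linear_combination -e3 + 2 * h3 - h4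
  have h8 : v 8 = v 7 * 3 := mul_left_cancel₀ two_ne_zero (by linear_combination e8 + h2)
  have h1 : v 1 = v 7 * 4 := by linear_combination -e2 + 2 * h2 - h3 - h8
  have h0 : v 0 = v 7 * 2 := by linear_combination -e1 + 2 * h1 - h2
  funext i
  fin_cases i <;> simp [mark, h0, h1, h2, h3, h4, h5, h6, h8]

theorem rank_cartanMatrix_nine : ((cartanMatrix 9).map (Int.cast : ℤ → K)).rank = 8 := by
  set M := (cartanMatrix 9).map (Int.cast : ℤ → K)
  have hker : LinearMap.ker M.mulVecLin = K ∙ (fun i => (mark i : K)) := by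
    ext v
    rw [LinearMap.mem_ker, Matrix.mulVecLin_apply, Submodule.mem_span_singleton]
    refine ⟨fun h => ⟨v 7, (eq_smul_mark K h).symm⟩, ?_⟩
    rintro ⟨c, rfl⟩
    rw [Matrix.mulVec_smul, mulVec_mark, smul_zero]
  have hmark : (fun i => (mark i : K)) ≠ 0 := fun h =>
    (mark_pos 0).ne' (Int.cast_eq_zero.1 (congrFun h 0))
  have h := LinearMap.finrank_range_add_finrank_ker M.mulVecLin
  rw [hker, finrank_span_singleton hmark, Module.finrank_fin_fun] at h
  exact Nat.succ.inj h

theorem rank_cartanMatrix_nine_add_one :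
    ((cartanMatrix 9).map (Int.cast : ℤ → K)).rank + 1 = Fintype.card (Fin 9) := by
  rw [rank_cartanMatrix_nine, Fintype.card_fin]

end Affine

theorem isAffineType_nine : IsAffineType (cartanMatrix 9) where
  toIsIndecomposableGCM := isIndecomposableGCM (by norm_num)
  corank := rank_cartanMatrix_nine_add_one ℝ
  exists_pos := ⟨fun i => mark i, fun i => Int.cast_pos.2 (mark_pos i), mulVec_mark ℝ⟩
  eq_zero _ := mulVec_eq_zero_of_nonneg_of_isSymm isSymm_map_cartanMatrix
    (fun i => Int.cast_pos.2 (mark_pos i)) (mulVec_mark ℝ)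

/-- The element `x` orthogonal to the canonical element with coordinates `x_n = n - 4k` for
`n ≥ 1`. The simple roots are negative on it, and the fundamental weights positive, if `k ≥ 10`. -/
noncomputable def antidominantVector (k : ℕ) : Cartan k := fun n =>
  if n = 0 then (7 * k ^ 2 - k) / 6 else n - 4 * k

theorem coord_zero_antidominantVector :
    coord k 0 (antidominantVector k) = (7 * k ^ 2 - k) / 6 :=
  coord_fin 0 _

theorem coord_succ_antidominantVector {n : ℕ} (hn : n < k) :
    coord k (n + 1) (antidominantVector k) = n + 1 - 4 * k := by
  simp [coord, hn, antidominantVector]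

theorem sum_coord_antidominantVector :
    ∑ n ∈ Finset.range k, coord k (n + 1) (antidominantVector k) =
      -3 * coord k 0 (antidominantVector k) := by
  have h (c : ℝ) (m : ℕ) : ∑ n ∈ Finset.range m, (n + 1 - c) = m * (m + 1) / 2 - c * m := by
    induction m with
    | zero => simp
    | succ m ih =>
      rw [Finset.sum_range_succ, ih]
      push_cast
      ring
  rw [Finset.sum_congr rfl fun n hn => coord_succ_antidominantVector (Finset.mem_range.1 hn), h,
    coord_zero_antidominantVector]
  ring

theorem root_antidominantVector_neg (hk : 10 ≤ k) (i : Fin k) :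
    root k i (antidominantVector k) < 0 := by
  have hk' : (10 : ℝ) ≤ k := mod_cast hk
  rw [root_apply]
  split_ifs with h
  · rw [coord_succ_antidominantVector (by omega), coord_succ_antidominantVector h]
    push_cast
    linarith
  · rw [coord_zero_antidominantVector, coord_succ_antidominantVector (by omega),
      coord_succ_antidominantVector (by omega), coord_succ_antidominantVector (by omega)]
    push_cast
    nlinarith

theorem fundamentalWeight_antidominantVector_pos (hk : 10 ≤ k) (i : Fin k) :
    0 < fundamentalWeight k i (antidominantVector k) := by
  have hk' : (10 : ℝ) ≤ k := mod_cast hk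
  have h0 : 0 < coord k 0 (antidominantVector k) := by
    rw [coord_zero_antidominantVector]
    nlinarith
  unfold fundamentalWeight
  split_ifs with h
  · simp only [LinearMap.add_apply, LinearMap.sum_apply, LinearMap.smul_apply, nsmul_eq_mul]
    obtain ⟨hi, hmin⟩ | ⟨hi, hmin⟩ | hmin : i.val = 0 ∧ min (i.val + 1) 3 = 1 ∨
        i.val = 1 ∧ min (i.val + 1) 3 = 2 ∨ min (i.val + 1) 3 = 3 := by omega
    all_goals rw [hmin]
    · rw [hi, Finset.sum_range_one, coord_succ_antidominantVector (by omega),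
        coord_zero_antidominantVector]
      push_cast
      nlinarith
    · rw [hi, Finset.sum_range_succ, Finset.sum_range_one,
        coord_succ_antidominantVector (by omega), coord_succ_antidominantVector (by omega),
        coord_zero_antidominantVector]
      push_cast
      nlinarith
    · have hneg (n : ℕ) (hn : n < k) : coord k (n + 1) (antidominantVector k) < 0 := by
        rw [coord_succ_antidominantVector hn]
        have : (n : ℝ) + 1 ≤ k := mod_cast hn
        linarith
      have hlt := Finset.sum_lt_sum_of_subset
        (f := fun n => -coord k (n + 1) (antidominantVector k))
        (Finset.range_subset_range.2 h.le) (Finset.mem_range.2 h) (by simp)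
        (neg_pos.2 (hneg _ h)) fun n hn _ => (neg_pos.2 (hneg n (Finset.mem_range.1 hn))).le
      rw [Finset.sum_neg_distrib, Finset.sum_neg_distrib, sum_coord_antidominantVector] at hlt
      push_cast
      linarith
  · exact h0

theorem exists_pos_mulVec_neg (hk : 10 ≤ k) : ∃ u : Fin k → ℝ, (∀ i, 0 < u i) ∧
    ∀ i, ((cartanMatrix k).map (Int.cast : ℤ → ℝ)).mulVec u i < 0 := by
  have hk3 : 3 ≤ k := by omega
  obtain ⟨u, hu⟩ := exists_corootComb_eq hk3 (x := antidominantVector k) (by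
    rw [minkowski_canonical, sum_coord_antidominantVector]
    ring)
  refine ⟨u, fun i => ?_, fun i => ?_⟩
  · rw [← fundamentalWeight_corootComb hk3 i u, hu]
    exact fundamentalWeight_antidominantVector_pos hk i
  · rw [← root_corootComb hk3, hu]
    exact root_antidominantVector_neg hk i

theorem isIndefiniteType (hk : 10 ≤ k) : IsIndefiniteType (cartanMatrix k) where
  toIsIndecomposableGCM := isIndecomposableGCM (by omega)
  exists_pos := exists_pos_mulVec_neg hk
  eq_zero _ hv hv0 :=
    have ⟨_, hu, hCu⟩ := exists_pos_mulVec_neg hk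
    eq_zero_of_nonneg_of_isSymm isSymm_map_cartanMatrix hu hCu hv hv0

end ESeries

/-! ### Realizations of matrices of corank one -/

theorem exists_apply_eq_one_of_linearIndependent {K V ι : Type*} [Field K] [AddCommGroup V]
    [Module K V] [Finite ι] {α : ι → Module.Dual K V} (h : LinearIndependent K α) (i : ι) :
    ∃ x, α i x = 1 ∧ ∀ j ≠ i, α j x = 0 := by
  have hi : α i ∉ Submodule.span K (Set.range fun j : ({i}ᶜ : Set ι) => α j) := by
    have := linearIndependent_iff_notMem_span.1 h i
    rwa [← Set.compl_eq_univ_sdiff, Set.image_eq_range] at this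
  obtain ⟨x, hx, hxi⟩ := SetLike.not_le_iff_exists.1 (mt mem_span_of_iInf_ker_le_ker hi)
  refine ⟨(α i x)⁻¹ • x, ?_, fun j hj => ?_⟩
  · rw [map_smul, smul_eq_mul, inv_mul_cancel₀ hxi]
  · rw [map_smul, (Submodule.mem_iInf _).1 hx ⟨j, hj⟩, smul_zero]

section CorankOne

variable {ι R K V W : Type*} [Fintype ι] [Field R] [CharZero R] [Field K]
  [CharZero K] [AddCommGroup V] [Module R V] [AddCommGroup W] [Module K W] {A : Matrix ι ι ℤ}
  {α : ι → Module.Dual R V} {αv : ι → V} {β : ι → Module.Dual K W} {βv : ι → W} {w : ι → ℤ} {i₀ : ι}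

theorem exists_basis_of_isRealization (H : IsRealization R A α αv)
    (hA : (A.map (Int.cast : ℤ → R)).rank + 1 = Fintype.card ι) (hw : A.mulVec w = 0)
    (hi₀ : w i₀ ≠ 0) : ∃ b : Module.Basis (Option ι) R V, (∀ i, b (some i) = αv i) ∧
      α i₀ (b none) = 1 ∧ ∀ j ≠ i₀, α j (b none) = 0 := by
  have := H.finite
  obtain ⟨d, hd₀, hd⟩ := exists_apply_eq_one_of_linearIndependent H.root_indep i₀
  let ℓ : Module.Dual R V := ∑ j, (w j : R) • α j
  have hℓ i : ℓ (αv i) = 0 := by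
    have := congrArg (Int.cast : ℤ → R) (congrFun hw i)
    simpa [ℓ, H.pairing, Matrix.mulVec, dotProduct, mul_comm] using this
  have hℓd : ℓ d = w i₀ := by
    rw [LinearMap.sum_apply, Finset.sum_eq_single i₀ (fun j _ hj => by simp [hd j hj]) (by simp)]
    simp [hd₀]
  have hd_notMem : d ∉ Submodule.span R (Set.range αv) := fun hmem => by
    have hspan : Submodule.span R (Set.range αv) ≤ LinearMap.ker ℓ :=
      Submodule.span_le.2 (Set.range_subset_iff.2 hℓ)
    exact hi₀ (Int.cast_eq_zero.1 (hℓd.symm.trans (hspan hmem)))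
  let v : Option ι → V := fun o => o.elim d αv
  have hv : LinearIndependent R v := linearIndependent_option.2 ⟨H.coroot_indep, hd_notMem⟩
  have hcard : Fintype.card (Option ι) = Module.finrank R V := by
    have := H.dim
    rw [Fintype.card_option]
    omega
  refine ⟨basisOfLinearIndependentOfCardEqFinrank hv hcard, fun i => ?_, ?_, fun j hj => ?_⟩
  · simp [v]
  · simp [v, hd₀]
  · simp [v, hd j hj]

theorem exists_baseChange_equiv_of_isRealization [Algebra R K] (H : IsRealization R A α αv)
    (H' : IsRealization K A β βv) (hR : (A.map (Int.cast : ℤ → R)).rank + 1 = Fintype.card ι)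
    (hK : (A.map (Int.cast : ℤ → K)).rank + 1 = Fintype.card ι) (hw : A.mulVec w = 0)
    (hi₀ : w i₀ ≠ 0) : ∃ ψ : (K ⊗[R] V) ≃ₗ[K] W, (∀ i, ψ (1 ⊗ₜ αv i) = βv i) ∧
      ∀ i x, β i (ψ (1 ⊗ₜ x)) = algebraMap R K (α i x) := by
  obtain ⟨b, hb, hb₀, hαb⟩ := exists_basis_of_isRealization H hR hw hi₀
  obtain ⟨c, hc, hc₀, hβc⟩ := exists_basis_of_isRealization H' hK hw hi₀
  let ψ := (b.baseChange K).equiv c (Equiv.refl _)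
  have hψ o : ψ (1 ⊗ₜ b o) = c o := by
    rw [← Module.Basis.baseChange_apply, Module.Basis.equiv_apply, Equiv.refl_apply]
  refine ⟨ψ, fun i => by rw [← hb, ← hc, hψ], fun i => ?_⟩
  suffices h : (β i ∘ₗ ψ.toLinearMap).restrictScalars R ∘ₗ TensorProduct.mk R K V 1 =
      Algebra.linearMap R K ∘ₗ α i from LinearMap.congr_fun h
  refine b.ext fun o => (congrArg (β i) (hψ o)).trans ?_
  cases o with
  | none =>
    by_cases hi : i = i₀
    · simp [hi, hb₀, hc₀]
    · simp [hαb i hi, hβc i hi]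
  | some j => simp [hb, hc, H.pairing, H'.pairing]

theorem exists_equiv_of_isRealization [Module R W] {β : ι → Module.Dual R W}
    (H : IsRealization R A α αv) (H' : IsRealization R A β βv)
    (hA : (A.map (Int.cast : ℤ → R)).rank + 1 = Fintype.card ι) (hw : A.mulVec w = 0)
    (hi₀ : w i₀ ≠ 0) :
    ∃ φ : V ≃ₗ[R] W, (∀ i, φ (αv i) = βv i) ∧ ∀ i x, β i (φ x) = α i x := by
  obtain ⟨ψ, hv, hα⟩ := exists_baseChange_equiv_of_isRealization H H' hA hA hw hi₀
  exact ⟨(TensorProduct.lid R V).symm.trans ψ, hv, hα⟩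

end CorankOne

namespace ESeries

theorem isRealization_nine : IsRealization ℝ (cartanMatrix 9) (root 9) (coroot 9) where
  finite := inferInstance
  root_indep := linearIndependent_root (by norm_num)
  coroot_indep := linearIndependent_coroot (by norm_num)
  pairing := root_coroot (by norm_num)
  dim := by simp [rank_cartanMatrix_nine]

end ESeries

/-! ### Splitting off the center -/

section CentralExtension

variable {ι K V Z L : Type*} [Field K] [AddCommGroup V] [Module K V] [LieRing L] [LieAlgebra K L]
  [LieRing Z] [LieAlgebra K Z] {A : Matrix ι ι ℤ} {α : ι → Module.Dual K V} {αv : ι → V}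
  {h : V →ₗ[K] L} {e f : ι → L}

theorem IsChevalleyFamily.isSerreFamily (H : IsChevalleyFamily K α αv h e f)
    (hα : ∀ i j, α j (αv i) = A i j) (hA : ∀ i j, i ≠ j → A i j ≤ 0) :
    IsSerreFamily A (fun i => h (αv i)) e f := by
  have hn {i j} (hij : i ≠ j) : (((-A i j).toNat + 1 : ℕ) : K) = 1 - α j (αv i) := by
    have : (((-A i j).toNat + 1 : ℕ) : ℤ) = 1 - A i j := by grind
    rw [hα]
    exact_mod_cast congrArg (Int.cast : ℤ → K) this
  refine ⟨⟨fun i j => H.hh _ _, fun i j => ?_, fun i j => ?_, H.ef_same, H.ef_ne⟩,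
    fun i j => ?_, fun i j => ?_⟩
  · rw [H.he, hα, Int.cast_smul_eq_zsmul]
  · rw [H.hf, hα, Int.cast_smul_eq_zsmul]
  · rcases eq_or_ne i j with rfl | hij
    · exact serreElement_self A _ i
    · exact H.serre_e i j hij _ (hn hij)
  · rcases eq_or_ne i j with rfl | hij
    · exact serreElement_self A _ i
    · exact H.serre_f i j hij _ (hn hij)

theorem IsChevalleyFamily.prod [IsLieAbelian Z] (H : IsChevalleyFamily K α αv h e f) {c : V →ₗ[K] Z}
    (hc : ∀ i, c (αv i) = 0) :
    IsChevalleyFamily K α αv (c.prod h) (fun i => (0, e i)) (fun i => (0, f i)) where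
  hh x y := Prod.ext (trivial_lie_zero ..) (H.hh x y)
  he x i := Prod.ext (by simp) (H.he x i)
  hf x i := Prod.ext (by simp) (H.hf x i)
  ef_same i := Prod.ext (by simp [hc]) (H.ef_same i)
  ef_ne i j hij := Prod.ext (lie_zero _) (H.ef_ne i j hij)
  serre_e i j hij n hn := by
    have := lieHom_map_iterate_lie (LieHom.inr K Z L) n (e i) (e j)
    rw [H.serre_e i j hij n hn, map_zero] at this
    exact this.symm
  serre_f i j hij n hn := by
    have := lieHom_map_iterate_lie (LieHom.inr K Z L) n (f i) (f j)
    rw [H.serre_f i j hij n hn, map_zero] at this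
    exact this.symm

/-- The morphism of Lie algebras on a product given by a linear map with central image on an
abelian factor and by a morphism on the other factor. -/
def lieCoprodOfCentral {L' : Type*} [LieRing L'] [LieAlgebra K L'] [IsLieAbelian Z] (c : Z →ₗ[K] L')
    (hc : ∀ z (x : L'), ⁅c z, x⁆ = 0) (F : L →ₗ⁅K⁆ L') : Z × L →ₗ⁅K⁆ L' where
  __ := c.coprod (F : L →ₗ[K] L')
  map_lie' := by
    rintro ⟨z, x⟩ ⟨z', x'⟩
    have hc' y : ⁅F x, c y⁆ = 0 := by rw [← lie_skew, hc, neg_zero]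
    change c ⁅z, z'⁆ + F ⁅x, x'⁆ = ⁅c z + F x, c z' + F x'⁆
    rw [trivial_lie_zero, map_zero, F.map_lie, add_lie, hc, lie_add, hc', zero_add,
      zero_add]

variable [Fintype ι] [DecidableEq ι]

theorem symm_eq_add_sum {Z : Type*} [AddCommGroup Z] [Module K Z] (T : V ≃ₗ[K] Z × (ι → K))
    (hT : ∀ i, T (αv i) = (0, Pi.single i 1)) (z : Z) (a : ι → K) :
    T.symm (z, a) = T.symm (z, 0) + ∑ i, a i • αv i := T.injective <| by
  simp only [map_add, map_sum, map_smul, LinearEquiv.apply_symm_apply, hT]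
  simp [Prod.ext_iff, Prod.fst_sum, Prod.snd_sum, ← Pi.single_smul, Finset.univ_sum_single]

variable [CharZero K]

theorem IsSerreFamily.isChevalleyFamily {h : ι → L} (S : IsSerreFamily A h e f)
    (hA : ∀ i j, i ≠ j → A i j ≤ 0) {b : V →ₗ[K] ι → K} (hα : ∀ j x, α j x = ∑ i, b x i * A i j)
    (hb : ∀ i, b (αv i) = Pi.single i 1) :
    IsChevalleyFamily K α αv (Fintype.linearCombination K h ∘ₗ b) e f := by
  have hαv i j : α j (αv i) = A i j := by simp [hα, hb, Pi.single_apply]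
  have hn {i j} {n : ℕ} (hij : i ≠ j) (h : (n : K) = 1 - α j (αv i)) : n = (-A i j).toNat + 1 := by
    rw [hαv] at h
    have h : (n : ℤ) = 1 - A i j := by exact_mod_cast h
    grind
  refine ⟨fun x y => ?_, fun x i => ?_, fun x i => ?_, fun i => ?_, S.ef_ne, ?_, ?_⟩
  · simp [Fintype.linearCombination_apply, sum_lie, lie_sum, S.hh]
  · simp [Fintype.linearCombination_apply, sum_lie, S.he, hα, Finset.sum_smul, mul_smul,
      Int.cast_smul_eq_zsmul]
  · simp [Fintype.linearCombination_apply, sum_lie, S.hf, hα, Finset.sum_smul, mul_smul,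
      Int.cast_smul_eq_zsmul]
  · simp [hb, S.ef_same, Fintype.linearCombination_apply_single]
  · rintro i j hij n h
    rw [hn hij h]
    exact S.serre_e i j
  · rintro i j hij n h
    rw [hn hij h]
    exact S.serre_f i j

theorem ChevalleyAlgebra.exists_equiv_prod_toLieAlgebra [IsLieAbelian Z]
    (hA : ∀ i j, i ≠ j → A i j ≤ 0) (T : V ≃ₗ[K] Z × (ι → K))
    (hα : ∀ j x, α j x = ∑ i, (T x).2 i * A i j) (hT : ∀ i, T (αv i) = (0, Pi.single i 1)) :
    ∃ Φ : ChevalleyAlgebra K α αv ≃ₗ⁅K⁆ Z × Matrix.ToLieAlgebra K A,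
      (∀ x, Φ (gen K α αv (.h x)) = ((T x).1, ∑ i, (T x).2 i • serreGen K A (.H i))) ∧
      ∀ i, Φ (gen K α αv (.e i)) = (0, serreGen K A (.E i)) ∧
        Φ (gen K α αv (.f i)) = (0, serreGen K A (.F i)) := by
  let b := LinearMap.snd K Z (ι → K) ∘ₗ T.toLinearMap
  let p := LinearMap.fst K Z (ι → K) ∘ₗ T.toLinearMap
  have hb i : b (αv i) = Pi.single i 1 := congrArg Prod.snd (hT i)
  have hp i : p (αv i) = 0 := congrArg Prod.fst (hT i)
  have H := ((isSerreFamily_serreGen K A).isChevalleyFamily hA hα hb).prod hp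
  have S := (isChevalleyFamily_gen α αv).isSerreFamily
    (fun i j => by simp [hα, hT, Pi.single_apply]) hA
  let c := genH α αv ∘ₗ T.symm.toLinearMap ∘ₗ LinearMap.inl K Z (ι → K)
  have hc z (y : ChevalleyAlgebra K α αv) : ⁅c z, y⁆ = 0 :=
    lie_genH_eq_zero (fun i => by simp [hα]) y
  let G := lieCoprodOfCentral c hc (S.lift K)
  have hG z x : G (z, x) = c z + S.lift K x := rfl
  have hF_h x : lift H (gen K α αv (.h x)) = ((T x).1, ∑ i, (T x).2 i • serreGen K A (.H i)) :=
    (lift_h H x).trans (Prod.ext rfl (Fintype.linearCombination_apply ..))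
  have hF_lift : (lift H).comp (S.lift K) = LieHom.inr K Z _ := serre_hom_ext fun x => by
    cases x <;> simp [serreElim, genH_apply, hF_h, hT, Pi.single_apply]
  have hFG : (lift H).comp G = LieHom.id := LieHom.ext fun ⟨z, x⟩ => by
    have hx := LieHom.congr_fun hF_lift x
    have hz : lift H (c z) = (z, 0) := by simp [c, genH_apply, hF_h]
    rw [LieHom.comp_apply] at hx
    rw [LieHom.comp_apply, hG, map_add, hz, hx]
    simp
  have hGF : G.comp (lift H) = LieHom.id := by
    refine hom_ext (LinearMap.ext fun x => ?_) (fun i => ?_) fun i => ?_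
    · have hx := congrArg (genH α αv) (symm_eq_add_sum T hT (T x).1 (T x).2)
      rw [Prod.mk.eta, T.symm_apply_apply] at hx
      change G (lift H (genH α αv x)) = genH α αv x
      rw [genH_apply, hF_h, hG, ← genH_apply, hx]
      simp [c, serreElim]
    · simp [hG, serreElim]
    · simp [hG, serreElim]
  exact ⟨lieEquivOfInverse (lift H) G hGF hFG, hF_h, fun i => ⟨lift_e H i, lift_f H i⟩⟩

end CentralExtension

namespace ESeries

attribute [local instance] LieRing.ofAssociativeRing

theorem isTrivialCentralExtension {k : ℕ} (hk : 3 ≤ k) (hk9 : k ≠ 9) :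
    IsTrivialCentralExtension k := by
  obtain ⟨T, hT⟩ := exists_equiv_prod hk hk9
  have hT_canonical : T.symm (canonical k) = (1, 0) := by simp [LinearEquiv.symm_apply_eq, hT]
  have hT_coroot i : T.symm (coroot k i) = (0, Pi.single i 1) := by
    simp [LinearEquiv.symm_apply_eq, hT, corootComb_apply, Pi.single_apply]
  have hroot j x : root k j x = ∑ i, (T.symm x).2 i * cartanMatrix k i j := by
    obtain ⟨⟨a, b⟩, rfl⟩ := T.surjective x
    rw [LinearEquiv.symm_apply_apply, hT]
    simp [root_canonical hk, corootComb_apply, root_coroot hk]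
  have : IsLieAbelian ℝ := isMulCommutative_iff_isLieAbelian.1 inferInstance
  obtain ⟨Φ, hΦ, hΦef⟩ := ChevalleyAlgebra.exists_equiv_prod_toLieAlgebra
    (fun _ _ => cartanMatrix_nonpos) T.symm hroot hT_coroot
  refine ⟨Φ, ?_, fun i => ⟨?_, hΦef i⟩⟩
  · simp [hΦ, hT_canonical]
  · have hsum : ∑ j, (Pi.single i 1 : Fin k → ℝ) j • serreGen ℝ (cartanMatrix k) (.H j) =
        serreGen ℝ (cartanMatrix k) (.H i) := by simp [Pi.single_apply]
    rw [hΦ, hT_coroot]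
    exact Prod.ext rfl hsum

end ESeries

/-! ### Nonvanishing of the generators -/

/-- Symmetric simply laced generalized Cartan matrices. -/
structure IsSymmetricSimplyLaced {ι : Type*} (A : Matrix ι ι ℤ) : Prop where
  diag : ∀ i, A i i = 2
  off_diag : ∀ i j, i ≠ j → A i j = 0 ∨ A i j = -1
  symm : ∀ i j, A i j = A j i

theorem ESeries.isSymmetricSimplyLaced (k : ℕ) :
    IsSymmetricSimplyLaced (ESeries.cartanMatrix k) where
  diag i := by simp [cartanMatrix]
  off_diag i j hij := by
    unfold cartanMatrix
    split_ifs <;> first | contradiction | simp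
  symm := cartanMatrix_symm

namespace IsWeakSerreFamily

variable {ι L : Type*} [LieRing L] {A : Matrix ι ι ℤ} {h e f : ι → L}

theorem symm (S : IsWeakSerreFamily A h e f) : IsWeakSerreFamily A (-h) f e where
  hh i j := by simp [S.hh]
  he i j := by simp [S.hf]
  hf i j := by simp [S.he]
  ef_same i := by rw [← lie_skew, S.ef_same]; rfl
  ef_ne i j hij := by rw [← lie_skew, S.ef_ne j i hij.symm, neg_zero]

theorem lie_e_f [DecidableEq ι] (S : IsWeakSerreFamily A h e f) (i j : ι) :
    ⁅e i, f j⁆ = if i = j then h i else 0 := by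
  split_ifs with hij
  · rw [hij, S.ef_same]
  · exact S.ef_ne i j hij

theorem lie_f_h (S : IsWeakSerreFamily A h e f) (i j : ι) : ⁅f i, h j⁆ = A j i • f i := by
  rw [← lie_skew, S.hf, neg_neg]

theorem lie_e_lie_f_f (S : IsWeakSerreFamily A h e f) {i j : ι} (hij : A i j = 0)
    (hji : A j i = 0) (l : ι) : ⁅e l, ⁅f i, f j⁆⁆ = 0 := by
  classical
  rw [leibniz_lie, S.lie_e_f, S.lie_e_f]
  split_ifs with hli hlj hlj
  · rw [hli, S.hf, S.lie_f_h, ← hli, hlj]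
    simp_all
  · simp [hli, S.hf, hij]
  · simp [hlj, S.lie_f_h, hji]
  · simp

theorem lie_e_lie_f_lie_f_f (S : IsWeakSerreFamily A h e f) {i j : ι} (hii : A i i = 2)
    (hij : A i j = -1) (hji : A j i = -1) (l : ι) : ⁅e l, ⁅f i, ⁅f i, f j⁆⁆⁆ = 0 := by
  classical
  rw [leibniz_lie, leibniz_lie (e l) (f i) (f j), S.lie_e_f, S.lie_e_f]
  split_ifs with hli hlj hlj
  · rw [← hli, ← hlj, hli, hii] at hij
    norm_num at hij
  · rw [hli, leibniz_lie, S.hf, S.hf, hij, hii]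
    simp only [two_smul, neg_smul, one_smul, neg_neg, add_zero, neg_add_rev, add_lie, neg_lie,
      lie_zero]
    abel
  · simp [hlj, S.lie_f_h, hji]
  · simp

theorem lie_e_serre_f (S : IsWeakSerreFamily A h e f) (hA : IsSymmetricSimplyLaced A)
    (l i j : ι) : ⁅e l, serreElement A f i j⁆ = 0 := by
  rcases eq_or_ne i j with rfl | hij
  · rw [serreElement_self, lie_zero]
  rcases hA.off_diag i j hij with h0 | h1
  · simpa [serreElement, h0] using S.lie_e_lie_f_f h0 (hA.symm j i ▸ h0) l
  · simpa [serreElement, h1] using S.lie_e_lie_f_lie_f_f (hA.diag i) h1 (hA.symm j i ▸ h1) l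

end IsWeakSerreFamily

section SerreElement

variable {ι L M : Type*} [LieRing L] [AddCommGroup M] [LieRingModule L M] {A : Matrix ι ι ℤ}
  {x : ι → L}

theorem lie_serreElement_eq_zero {v : M} (hx : ∀ i, ⁅x i, v⁆ = 0) (i j : ι) :
    ⁅serreElement A x i j, v⁆ = 0 := by
  rw [serreElement]
  induction (-A i j).toNat with
  | zero => rw [Function.iterate_zero_apply, lie_lie, hx, hx, lie_zero, lie_zero, sub_zero]
  | succ n ih => rw [Function.iterate_succ_apply', lie_lie, ih, hx, lie_zero, lie_zero, sub_zero]

theorem map_lie_serreElement_eq_zero {N : Type*} [AddCommGroup N] (φ : M →+ N)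
    (hx : ∀ i v, φ ⁅x i, v⁆ = 0) (i j : ι) (v : M) : φ ⁅serreElement A x i j, v⁆ = 0 := by
  rw [serreElement]
  induction (-A i j).toNat generalizing v with
  | zero => rw [Function.iterate_zero_apply, lie_lie, map_sub, hx, hx, sub_zero]
  | succ n ih => rw [Function.iterate_succ_apply', lie_lie, map_sub, hx, ih, sub_zero]

end SerreElement

namespace VermaModule

attribute [local instance] LieRing.ofAssociativeRing

variable {ι : Type*} (K : Type*) [CommRing K] (A : Matrix ι ι ℤ)

/-- The underlying space of the Verma module (of the contragredient algebra, without the Serre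
relations) whose highest weight is `1` on all coroots: the word `[i₁, …, iₙ]` stands for
`f i₁ ⋯ f iₙ v` with `v` the highest weight vector. -/
abbrev Space (ι K : Type*) [CommRing K] : Type _ := List ι →₀ K

/-- The value of the weight of a word on the coroot `i`. -/
def weight (i : ι) (w : List ι) : K := 1 - ((w.map (A i)).sum : ℤ)

/-- The action of a coroot. -/
noncomputable def opH (i : ι) : Module.End K (Space ι K) :=
  Finsupp.linearCombination K fun w => Finsupp.single w (weight K A i w)

/-- The action of a lowering operator. -/
noncomputable def opF (i : ι) : Module.End K (Space ι K) :=
  Finsupp.linearCombination K fun w => Finsupp.single (i :: w) 1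

section Basic

variable {K A}

theorem opH_single (i : ι) (w : List ι) :
    opH K A i (Finsupp.single w 1) = weight K A i w • Finsupp.single w 1 := by
  simp [opH]

theorem opF_single (i : ι) (w : List ι) :
    opF K i (Finsupp.single w 1) = Finsupp.single (i :: w) 1 := by
  simp [opF]

theorem weight_cons (i j : ι) (w : List ι) :
    weight K A i (j :: w) = weight K A i w - A i j := by
  simp [weight, sub_add_eq_sub_sub_swap]

theorem linearMap_ext {M : Type*} [AddCommGroup M] [Module K M] {S T : Space ι K →ₗ[K] M}
    (h : ∀ w, S (Finsupp.single w 1) = T (Finsupp.single w 1)) : S = T := by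
  ext1 w
  ext1
  exact h w

theorem opF_apply_nil (i : ι) (x : Space ι K) : opF K i x [] = 0 := by
  have : Finsupp.lapply [] ∘ₗ opF K i = 0 := linearMap_ext fun w => by simp [opF]
  exact LinearMap.congr_fun this x

theorem opH_apply_nil (i : ι) (x : Space ι K) : opH K A i x [] = x [] := by
  have : Finsupp.lapply [] ∘ₗ opH K A i = Finsupp.lapply [] :=
    linearMap_ext fun w => by cases w <;> simp [opH, weight]
  exact LinearMap.congr_fun this x

theorem opH_opF (i j : ι) (x : Space ι K) :
    opH K A i (opF K j x) = opF K j (opH K A i x) - A i j • opF K j x := by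
  have : opH K A i ∘ₗ opF K j = opF K j ∘ₗ opH K A i - A i j • opF K j := by
    refine linearMap_ext fun w => ?_
    simp only [LinearMap.comp_apply, LinearMap.sub_apply, LinearMap.smul_apply, opF_single,
      opH_single, map_smul, weight_cons, sub_smul, Int.cast_smul_eq_zsmul]
  exact LinearMap.congr_fun this x

end Basic

variable [DecidableEq ι]

/-- The action of a raising operator on words. -/
noncomputable def raise (i : ι) : List ι → Space ι K
  | [] => 0
  | j :: w => opF K j (raise i w) + if i = j then Finsupp.single w (weight K A i w) else 0

/-- The action of a raising operator. -/
noncomputable def opE (i : ι) : Module.End K (Space ι K) :=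
  Finsupp.linearCombination K (raise K A i)

variable {K A}

theorem opE_single_nil (i : ι) : opE K A i (Finsupp.single [] 1) = 0 := by
  simp [opE, raise]

theorem opE_single_cons (i j : ι) (w : List ι) :
    opE K A i (Finsupp.single (j :: w) 1) = opF K j (opE K A i (Finsupp.single w 1)) +
      if i = j then opH K A i (Finsupp.single w 1) else 0 := by
  simp [opE, raise, opH]

theorem opH_opE (i j : ι) (x : Space ι K) :
    opH K A i (opE K A j x) = opE K A j (opH K A i x) + A i j • opE K A j x := by
  have : opH K A i ∘ₗ opE K A j = opE K A j ∘ₗ opH K A i + A i j • opE K A j := by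
    refine linearMap_ext fun w => ?_
    simp only [LinearMap.comp_apply, LinearMap.add_apply, LinearMap.smul_apply, opH_single,
      map_smul]
    rw [← Int.cast_smul_eq_zsmul K]
    induction w with
    | nil => simp [opE_single_nil]
    | cons l w ih =>
      rw [opE_single_cons, map_add, opH_opF, ih, weight_cons, map_add, map_smul, map_smul,
        ← Int.cast_smul_eq_zsmul K]
      split_ifs with hjl
      · subst hjl
        rw [opH_single, map_smul, opH_single]
        module
      · rw [map_zero]
        module
  exact LinearMap.congr_fun this x

theorem opE_opF (i j : ι) (x : Space ι K) :
    opE K A i (opF K j x) = opF K j (opE K A i x) + if i = j then opH K A i x else 0 := by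
  have : opE K A i ∘ₗ opF K j = opF K j ∘ₗ opE K A i + if i = j then opH K A i else 0 := by
    refine linearMap_ext fun w => ?_
    split_ifs with hij <;> simp [opF_single, opE_single_cons, hij]
  have := LinearMap.congr_fun this x
  split_ifs at this ⊢ <;> exact this

theorem isWeakSerreFamily :
    IsWeakSerreFamily A (L := Module.End K (Space ι K)) (opH K A) (opE K A) (opF K) where
  hh i j := sub_eq_zero.2 <| linearMap_ext fun w => by
    rw [Module.End.mul_apply, Module.End.mul_apply, opH_single, opH_single, map_smul, map_smul,
      opH_single, opH_single, smul_comm]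
  he i j := sub_eq_iff_eq_add'.2 <| LinearMap.ext (opH_opE i j)
  hf i j := sub_eq_iff_eq_add'.2 <| LinearMap.ext fun x =>
    (opH_opF i j x).trans (sub_eq_add_neg ..)
  ef_same i := sub_eq_iff_eq_add'.2 <| LinearMap.ext fun x => by simpa using opE_opF i i x
  ef_ne i j hij := sub_eq_zero.2 <| LinearMap.ext fun x => by simpa [hij] using opE_opF i j x

theorem serreElement_opE_eq_zero (hA : IsSymmetricSimplyLaced A) (i j : ι) :
    serreElement A (opE K A) i j = 0 := by
  -- An operator that commutes with the lowering operators is determined by its value on the highest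
  -- weight vector.
  have hF (l : ι) (x : Space ι K) : serreElement A (opE K A) i j (opF K l x) =
      opF K l (serreElement A (opE K A) i j x) :=
    (sub_eq_zero.1 (LinearMap.congr_fun
      ((isWeakSerreFamily (K := K)).symm.lie_e_serre_f hA l i j) x)).symm
  refine linearMap_ext fun w => ?_
  rw [LinearMap.zero_apply]
  induction w with
  | nil =>
    have hE (l : ι) : ⁅opE K A l, Finsupp.single ([] : List ι) (1 : K)⁆ = 0 := opE_single_nil l
    exact lie_serreElement_eq_zero hE i j
  | cons l w ih => rw [← opF_single, hF, ih, map_zero]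

variable (K A) in
/-- The radical of the contravariant form: the vectors from which no product of raising operators
leads to a vector with nonzero highest weight component. -/
noncomputable def radical : Submodule K (Space ι K) :=
  ⨅ T ∈ Submonoid.closure (Set.range (opE K A)), LinearMap.ker (Finsupp.lapply [] ∘ₗ T)

theorem mem_radical {x : Space ι K} :
    x ∈ radical K A ↔ ∀ T ∈ Submonoid.closure (Set.range (opE K A)), T x [] = 0 := by
  simp [radical]

theorem apply_nil_of_mem_radical {x : Space ι K} (hx : x ∈ radical K A) : x [] = 0 :=
  mem_radical.1 hx 1 (one_mem _)

theorem opE_mem_radical (i : ι) {x : Space ι K} (hx : x ∈ radical K A) :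
    opE K A i x ∈ radical K A :=
  mem_radical.2 fun T hT =>
    mem_radical.1 hx (T * opE K A i) (mul_mem hT (Submonoid.subset_closure ⟨i, rfl⟩))

theorem opH_mem_radical (i : ι) {x : Space ι K} (hx : x ∈ radical K A) :
    opH K A i x ∈ radical K A := by
  refine mem_radical.2 fun T hT => ?_
  induction hT using Submonoid.closure_induction_right generalizing x with
  | one => simpa [opH_apply_nil] using apply_nil_of_mem_radical hx
  | mul_right T hT _ hE ih =>
    obtain ⟨j, rfl⟩ := hE
    have hEx := opE_mem_radical j hx
    rw [Module.End.mul_apply, eq_sub_of_add_eq (opH_opE i j x).symm, map_sub, map_zsmul,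
      Finsupp.sub_apply, Finsupp.smul_apply, ih hEx, mem_radical.1 hEx T hT, smul_zero, sub_zero]

theorem opF_mem_radical (i : ι) {x : Space ι K} (hx : x ∈ radical K A) :
    opF K i x ∈ radical K A := by
  refine mem_radical.2 fun T hT => ?_
  induction hT using Submonoid.closure_induction_right generalizing x with
  | one => exact opF_apply_nil i x
  | mul_right T hT _ hE ih =>
    obtain ⟨j, rfl⟩ := hE
    rw [Module.End.mul_apply, opE_opF, map_add, Finsupp.add_apply, ih (opE_mem_radical j hx),
      zero_add]
    split_ifs
    · exact mem_radical.1 (opH_mem_radical j hx) T hT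
    · simp

theorem serreElement_opF_mem_radical (hA : IsSymmetricSimplyLaced A) (i j : ι) (x : Space ι K) :
    serreElement A (opF K) i j x ∈ radical K A := by
  have hcomm (T) (hT : T ∈ Submonoid.closure (Set.range (opE K A))) :
      Commute T (serreElement A (opF K) i j) := by
    induction hT using Submonoid.closure_induction with
    | mem _ hE =>
      obtain ⟨l, rfl⟩ := hE
      exact sub_eq_zero.1 (isWeakSerreFamily.lie_e_serre_f hA l i j)
    | one => exact Commute.one_left _
    | mul T T' _ _ hT hT' => exact hT.mul_left hT'
  refine mem_radical.2 fun T hT => ?_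
  rw [← Module.End.mul_apply, (hcomm T hT).eq]
  exact map_lie_serreElement_eq_zero (x := opF K) (Finsupp.lapply (R := K) []).toAddMonoidHom
    opF_apply_nil i j (T x)

end VermaModule

section Stabilizer

attribute [local instance] LieRing.ofAssociativeRing

variable {K M : Type*} [CommRing K] [AddCommGroup M] [Module K M] (N : Submodule K M)

/-- The Lie algebra of the endomorphisms that map the submodule `N` into itself. -/
def endStabilizer : LieSubalgebra K (Module.End K M) where
  carrier := {T | ∀ x ∈ N, T x ∈ N}
  add_mem' hS hT x hx := N.add_mem (hS x hx) (hT x hx)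
  zero_mem' _ _ := N.zero_mem
  smul_mem' c _ hT x hx := N.smul_mem c (hT x hx)
  lie_mem' hS hT x hx := N.sub_mem (hS _ (hT x hx)) (hT _ (hS x hx))

/-- The action on the quotient by `N` of the endomorphisms that map `N` into itself. -/
def endQuotient : endStabilizer N →ₗ⁅K⁆ Module.End K (M ⧸ N) where
  toFun T := N.mapQ N T.1 T.2
  map_add' _ _ := N.linearMap_qext rfl
  map_smul' _ _ := N.linearMap_qext rfl
  map_lie' := N.linearMap_qext rfl

theorem coe_serreElement {ι : Type*} (A : Matrix ι ι ℤ) (x : ι → endStabilizer N) (i j : ι) :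
    (serreElement A x i j).1 = serreElement A (fun l => (x l).1) i j :=
  map_serreElement (endStabilizer N).incl x i j

theorem endQuotient_eq_zero {T : endStabilizer N} (hT : ∀ x, T.1 x ∈ N) : endQuotient N T = 0 :=
  N.linearMap_qext <| LinearMap.ext fun x => (Submodule.Quotient.mk_eq_zero N).2 (hT x)

end Stabilizer

section Nonvanishing

attribute [local instance] LieRing.ofAssociativeRing

open VermaModule

variable {ι K : Type*} [DecidableEq ι] [CommRing K] {A : Matrix ι ι ℤ}

theorem exists_isSerreFamily_end (hA : IsSymmetricSimplyLaced A) :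
    ∃ h f : ι → Module.End K (Space ι K ⧸ radical K A),
      IsSerreFamily A h
        (fun i => (radical K A).mapQ (radical K A) (opE K A i) fun _ => opE_mem_radical i) f := by
  let h (i : ι) : endStabilizer (radical K A) := ⟨opH K A i, fun _ => opH_mem_radical i⟩
  let e (i : ι) : endStabilizer (radical K A) := ⟨opE K A i, fun _ => opE_mem_radical i⟩
  let f (i : ι) : endStabilizer (radical K A) := ⟨opF K i, fun _ => opF_mem_radical i⟩
  have W := isWeakSerreFamily (K := K) (A := A)
  have S : IsWeakSerreFamily A h e f :=
    { hh := fun i j => Subtype.ext (W.hh i j)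
      he := fun i j => Subtype.ext (W.he i j)
      hf := fun i j => Subtype.ext (W.hf i j)
      ef_same := fun i => Subtype.ext (W.ef_same i)
      ef_ne := fun i j hij => Subtype.ext (W.ef_ne i j hij) }
  refine ⟨_, _, S.map (endQuotient _), fun i j => ?_, fun i j => ?_⟩
  · change serreElement A (endQuotient _ ∘ e) i j = 0
    rw [← map_serreElement]
    refine endQuotient_eq_zero _ fun x => ?_
    rw [coe_serreElement]
    change serreElement A (opE K A) i j x ∈ _
    rw [serreElement_opE_eq_zero hA]
    exact zero_mem _
  · rw [← map_serreElement]
    refine endQuotient_eq_zero _ fun x => ?_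
    rw [coe_serreElement]
    exact serreElement_opF_mem_radical hA i j x

theorem serreGen_E_ne_zero [Nontrivial K] (hA : IsSymmetricSimplyLaced A) (i : ι) :
    serreGen K A (.E i) ≠ 0 := by
  obtain ⟨h, f, S⟩ := exists_isSerreFamily_end (K := K) hA
  intro h0
  have hmap := S.lift_serreGen (K := K) (.E i)
  rw [h0, map_zero] at hmap
  have hmem : opE K A i (Finsupp.single [i] 1) ∈ radical K A :=
    (Submodule.Quotient.mk_eq_zero _).1
      (LinearMap.congr_fun hmap (Submodule.Quotient.mk (Finsupp.single [i] 1))).symm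
  simpa [opE_single_cons, opE_single_nil, opH_single, weight] using apply_nil_of_mem_radical hmem

end Nonvanishing

/-! ### Semisimplicity of finite type algebras -/

section PosDef

open scoped Matrix

variable {ι : Type*} [Fintype ι]

/-- Cauchy–Schwarz for the form `M`, applied to `x` and `M⁻¹ *ᵥ Pi.single i 1`. -/
theorem sq_apply_le_of_posDef [DecidableEq ι] {M : Matrix ι ι ℝ} (hM : M.PosDef) (x : ι → ℝ)
    (i : ι) : x i ^ 2 ≤ M⁻¹ i i * (x ⬝ᵥ M *ᵥ x) := by
  set y := M⁻¹ *ᵥ Pi.single i 1 with hy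
  have hMy : M *ᵥ y = Pi.single i 1 := by
    rw [hy, Matrix.mulVec_mulVec, Matrix.mul_nonsing_inv _ ((Matrix.isUnit_iff_isUnit_det M).1
      hM.isUnit), Matrix.one_mulVec]
  have hyMx : y ⬝ᵥ M *ᵥ x = x i := by
    have hMt : Mᵀ = M := hM.isHermitian
    rw [Matrix.dotProduct_mulVec, ← Matrix.mulVec_transpose, hMt, hMy, single_one_dotProduct]
  have hdiscrim := discrim_le_zero fun t : ℝ => by
    have hnonneg := hM.posSemidef.dotProduct_mulVec_nonneg (x + t • y)
    rw [star_trivial] at hnonneg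
    simp only [Matrix.mulVec_add, Matrix.mulVec_smul, add_dotProduct, dotProduct_add,
      smul_dotProduct, dotProduct_smul, hMy, hyMx, dotProduct_single_one, smul_eq_mul] at hnonneg
    change 0 ≤ y i * (t * t) + 2 * x i * t + x ⬝ᵥ M *ᵥ x
    simp only [Pi.add_apply, Pi.smul_apply, smul_eq_mul] at hnonneg
    linarith
  have hyi : y i = M⁻¹ i i := by rw [hy, Matrix.mulVec_single_one, Matrix.col_apply]
  rw [discrim, hyi] at hdiscrim
  linarith

/-- The simply laced generalized Cartan matrices of finite type. -/
structure IsPositiveSimplyLaced (A : Matrix ι ι ℤ) : Prop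
    extends IsSymmetricSimplyLaced A where
  posDef : (A.map (Int.cast : ℤ → ℝ)).PosDef

theorem intCast_dotProduct_mulVec (A : Matrix ι ι ℤ) (b : ι → ℤ) :
    ((b ⬝ᵥ A *ᵥ b : ℤ) : ℝ) =
      (Int.cast ∘ b) ⬝ᵥ A.map (Int.cast : ℤ → ℝ) *ᵥ (Int.cast ∘ b) := by
  simp [dotProduct, Matrix.mulVec]

namespace IsPositiveSimplyLaced

variable {A : Matrix ι ι ℤ}

theorem dotProduct_mulVec_pos (P : IsPositiveSimplyLaced A) {b : ι → ℤ} (hb : b ≠ 0) :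
    0 < b ⬝ᵥ A *ᵥ b := by
  have hb' : ((↑) ∘ b : ι → ℝ) ≠ 0 := fun h => hb (funext fun i => by simpa using congrFun h i)
  have h := P.posDef.dotProduct_mulVec_pos hb'
  rw [star_trivial, ← intCast_dotProduct_mulVec] at h
  exact_mod_cast h

theorem eq_zero_of_mulVec_eq_zero (P : IsPositiveSimplyLaced A) {b : ι → ℤ}
    (hb : A *ᵥ b = 0) : b = 0 := by
  by_contra hb0
  simpa [hb] using P.dotProduct_mulVec_pos hb0

theorem det_ne_zero [DecidableEq ι] (P : IsPositiveSimplyLaced A) : A.det ≠ 0 := fun h =>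
  have ⟨_, hv, hv0⟩ := Matrix.exists_mulVec_eq_zero_iff.2 h
  hv (P.eq_zero_of_mulVec_eq_zero hv0)

theorem finite_dotProduct_mulVec_eq (P : IsPositiveSimplyLaced A) (n : ℤ) :
    {b : ι → ℤ | b ⬝ᵥ A *ᵥ b = n}.Finite := by
  classical
  let N i := ⌈(A.map (Int.cast : ℤ → ℝ))⁻¹ i i * n⌉
  refine (Set.finite_Icc (-N) N).subset fun b hb => ?_
  have hsq i : b i ^ 2 ≤ N i := by
    have h := sq_apply_le_of_posDef P.posDef (Int.cast ∘ b) i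
    rw [← intCast_dotProduct_mulVec, show _ = n from hb] at h
    have h' := h.trans (Int.le_ceil _)
    rw [Function.comp_apply] at h'
    exact_mod_cast h'
  refine ⟨fun i => neg_le.1 ?_, fun i => (Int.le_self_sq _).trans (hsq i)⟩
  exact (Int.le_self_sq (-b i)).trans ((neg_sq (b i)).trans_le (hsq i))

end IsPositiveSimplyLaced

end PosDef

section WeightSpaces

open scoped Matrix

variable {K ι L : Type*} [CommRing K] [Fintype ι] [LieRing L] [LieAlgebra K L]

/-- The weight space, with respect to the coroots `h`, of the element `∑ i, β i • α i` of the root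
lattice, where `A` holds the values of the simple roots `α` on the coroots. -/
def latticeWeightSpace (K : Type*) [CommRing K] [LieAlgebra K L] (A : Matrix ι ι ℤ) (h : ι → L)
    (β : ι → ℤ) : Submodule K L where
  carrier := {x | ∀ i, ⁅h i, x⁆ = (A *ᵥ β) i • x}
  zero_mem' i := by rw [lie_zero, smul_zero]
  add_mem' hx hy i := by rw [lie_add, hx, hy, smul_add]
  smul_mem' c x hx i := by rw [lie_smul, hx, smul_comm]

variable {A : Matrix ι ι ℤ} {h : ι → L}

theorem latticeWeightSpace_neg (β : ι → ℤ) :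
    latticeWeightSpace K A h (-β) = latticeWeightSpace K A (-h) β := by
  ext x
  exact forall_congr' fun i => by
    rw [Matrix.mulVec_neg, Pi.neg_apply, Pi.neg_apply, neg_lie, neg_smul, neg_eq_iff_eq_neg]

theorem lie_mem_latticeWeightSpace {β γ : ι → ℤ} {x y : L} (hx : x ∈ latticeWeightSpace K A h β)
    (hy : y ∈ latticeWeightSpace K A h γ) : ⁅x, y⁆ ∈ latticeWeightSpace K A h (β + γ) := fun i => by
  rw [leibniz_lie, hx, hy, smul_lie, lie_smul, Matrix.mulVec_add, ← add_smul, Pi.add_apply]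

theorem zsmul_mem_iff_of_ne_zero {K M : Type*} [DivisionRing K] [CharZero K] [AddCommGroup M]
    [Module K M] (N : Submodule K M) {n : ℤ} (hn : n ≠ 0) {x : M} : n • x ∈ N ↔ x ∈ N := by
  rw [← Int.cast_smul_eq_zsmul K, N.smul_mem_iff (Int.cast_ne_zero.2 hn)]

theorem mem_of_sum_mem_of_mem_latticeWeightSpace {K : Type*} [Field K] [CharZero K]
    [LieAlgebra K L] (hA : ∀ b : ι → ℤ, A *ᵥ b = 0 → b = 0) (I : Submodule K L)
    (hI : ∀ i, ∀ x ∈ I, ⁅h i, x⁆ ∈ I) {s : Finset (ι → ℤ)} {x : (ι → ℤ) → L}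
    (hx : ∀ β ∈ s, x β ∈ latticeWeightSpace K A h β) (hs : ∑ β ∈ s, x β ∈ I) :
    ∀ β ∈ s, x β ∈ I := by
  classical
  induction s using Finset.induction_on generalizing x with
  | empty => simp
  | insert a s ha ih =>
    have hmem : ∀ b ∈ s, x b ∈ I := by
      intro b hb
      have hne : A *ᵥ b ≠ A *ᵥ a := fun hab => by
        rw [← sub_eq_zero, ← Matrix.mulVec_sub] at hab
        exact ha (sub_eq_zero.1 (hA _ hab) ▸ hb)
      obtain ⟨i, hi⟩ := Function.ne_iff.1 hne
      -- `ad (h i) - (A *ᵥ a) i` kills the summand at `a` and rescales the others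
      have hsum : ∑ β ∈ s, ((A *ᵥ β) i - (A *ᵥ a) i) • x β =
          ⁅h i, ∑ β ∈ insert a s, x β⁆ - (A *ᵥ a) i • ∑ β ∈ insert a s, x β := by
        rw [lie_sum, Finset.smul_sum, ← Finset.sum_sub_distrib, Finset.sum_insert ha,
          hx a (Finset.mem_insert_self a s), sub_self, zero_add]
        exact Finset.sum_congr rfl fun β hβ => by
          rw [hx β (Finset.mem_insert_of_mem hβ), sub_smul]
      have hb' := ih (fun β hβ => zsmul_mem (hx β (Finset.mem_insert_of_mem hβ)) _)
        (hsum ▸ sub_mem (hI i _ hs) (zsmul_mem hs _)) b hb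
      exact (zsmul_mem_iff_of_ne_zero I (sub_ne_zero.2 hi)).1 hb'
    rw [Finset.sum_insert ha, I.add_mem_iff_left (sum_mem hmem)] at hs
    exact Finset.forall_mem_insert _ _ _ |>.2 ⟨hs, hmem⟩

end WeightSpaces

section Words

variable {ι L : Type*} [LieRing L]

/-- The iterated bracket `⁅e i₁, ⁅e i₂, …, e iₙ⁆⁆` along a word, which is `0` for the empty word. -/
def lieWord (e : ι → L) : List ι → L
  | [] => 0
  | [i] => e i
  | i :: j :: w => ⁅e i, lieWord e (j :: w)⁆

theorem lieWord_cons (e : ι → L) (i : ι) {w : List ι} (hw : w ≠ []) :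
    lieWord e (i :: w) = ⁅e i, lieWord e w⁆ := by
  obtain ⟨j, w, rfl⟩ := List.exists_cons_of_ne_nil hw
  rfl

theorem lieWord_replicate (e : ι → L) (i : ι) (n : ℕ) :
    lieWord e (List.replicate (n + 2) i) = 0 := by
  induction n with
  | zero => exact lie_self _
  | succ n ih => rw [List.replicate_succ, lieWord_cons e i (by simp), ih, lie_zero]

variable [DecidableEq ι]

/-- The element of the root lattice given by a word, counting the occurrences of each letter. -/
def wordContent (w : List ι) : ι → ℤ := fun i => w.count i

theorem wordContent_singleton (i : ι) : wordContent [i] = Pi.single i 1 := by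
  ext j
  simp [wordContent, List.count_singleton, Pi.single_apply, eq_comm (a := i)]

theorem wordContent_cons (i : ι) (w : List ι) :
    wordContent (i :: w) = Pi.single i 1 + wordContent w := by
  ext j
  simp [wordContent, List.count_cons, Pi.single_apply, eq_comm (a := i), add_comm]

theorem wordContent_nonneg (w : List ι) : 0 ≤ wordContent w := fun i => by simp [wordContent]

theorem wordContent_eq_zero {w : List ι} : wordContent w = 0 ↔ w = [] := by
  refine ⟨fun hw => List.eq_nil_iff_forall_not_mem.2 fun i hi => ?_, fun hw => by subst hw; rfl⟩
  have := List.count_pos_iff.2 hi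
  have := congrFun hw i
  simp only [wordContent, Pi.zero_apply] at this
  omega

theorem eq_replicate_of_wordContent_eq_single {w : List ι} {i : ι} {m : ℤ}
    (hw : wordContent w = Pi.single i m) : w = List.replicate w.length i := by
  refine List.eq_replicate_of_mem fun j hj => ?_
  by_contra hji
  have hcount : (w.count j : ℤ) = 0 := by simpa [wordContent, hji] using congrFun hw j
  exact (List.count_pos_iff.2 hj).ne' (mod_cast hcount)

theorem mulVec_wordContent [Fintype ι] (A : Matrix ι ι ℤ) (w : List ι) (i : ι) :
    A.mulVec (wordContent w) i = (w.map (A i)).sum := by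
  induction w with
  | nil => simp [wordContent_eq_zero.2 rfl]
  | cons j w ih => simp [wordContent_cons, Matrix.mulVec_add, ih]

theorem sum_wordContent [Fintype ι] (w : List ι) : ∑ i, wordContent w i = w.length := by
  have := Multiset.sum_count_eq_card (s := Finset.univ) (m := (w : Multiset ι)) (by simp)
  simp only [Multiset.coe_count, Multiset.coe_card] at this
  simp only [wordContent]
  exact_mod_cast this

end Words

section Spanning

open scoped Matrix

variable {K ι L : Type*} [CommRing K] [LieRing L] [LieAlgebra K L] {A : Matrix ι ι ℤ}
  {h e f : ι → L}

/-- The span of the coroots `h` and of the iterated brackets of the elements `e`. -/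
def borelSubmodule (K : Type*) [CommRing K] [LieAlgebra K L] (h e : ι → L) : Submodule K L :=
  Submodule.span K (Set.range h ∪ Set.range (lieWord e))

theorem mem_borelSubmodule (i : ι) : h i ∈ borelSubmodule K h e :=
  Submodule.subset_span (.inl ⟨i, rfl⟩)

theorem lieWord_mem_borelSubmodule (w : List ι) : lieWord e w ∈ borelSubmodule K h e :=
  Submodule.subset_span (.inr ⟨w, rfl⟩)

theorem borelSubmodule_le {N : Submodule K L} (hh : ∀ i, h i ∈ N) (he : ∀ w, lieWord e w ∈ N) :
    borelSubmodule K h e ≤ N := by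
  rw [borelSubmodule, Submodule.span_le, Set.union_subset_iff, Set.range_subset_iff,
    Set.range_subset_iff]
  exact ⟨hh, he⟩

theorem borelSubmodule_neg : borelSubmodule K (-h) e = borelSubmodule K h e := by
  refine le_antisymm (borelSubmodule_le (fun i => neg_mem (mem_borelSubmodule i))
    lieWord_mem_borelSubmodule) (borelSubmodule_le (fun i => ?_) lieWord_mem_borelSubmodule)
  simpa using neg_mem (mem_borelSubmodule (K := K) (h := -h) (e := e) i)

namespace IsWeakSerreFamily

theorem lie_mem_borelSubmodule (S : IsWeakSerreFamily A h e f) (i : ι) {x : L}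
    (hx : x ∈ borelSubmodule K h e) : ⁅e i, x⁆ ∈ borelSubmodule K h e := by
  refine (borelSubmodule_le (fun j => ?_) fun w => ?_ :
    _ ≤ (borelSubmodule K h e).comap (LieAlgebra.ad K L (e i) : L →ₗ[K] L)) hx
  · rw [Submodule.mem_comap, LieAlgebra.ad_apply, ← lie_skew, S.he]
    exact neg_mem (zsmul_mem (lieWord_mem_borelSubmodule [i]) _)
  · rw [Submodule.mem_comap, LieAlgebra.ad_apply]
    rcases eq_or_ne w [] with rfl | hw
    · rw [lieWord, lie_zero]
      exact zero_mem _
    · rw [← lieWord_cons e i hw]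
      exact lieWord_mem_borelSubmodule _

theorem lie_h_lieWord (S : IsWeakSerreFamily A h e f) (i : ι) (w : List ι) :
    ⁅h i, lieWord e w⁆ = (w.map (A i)).sum • lieWord e w := by
  induction w with
  | nil => simp [lieWord]
  | cons j w ih =>
    rcases eq_or_ne w [] with rfl | hw
    · simp [lieWord, S.he]
    · rw [lieWord_cons e j hw, leibniz_lie, S.he, ih, smul_lie, lie_smul, ← add_smul,
        List.map_cons, List.sum_cons]

theorem lie_lieWord_mem_borelSubmodule (S : IsWeakSerreFamily A h e f) (i : ι) (w : List ι) :
    ⁅e i, lieWord f w⁆ ∈ borelSubmodule K h f := by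
  classical
  induction w with
  | nil => simp [lieWord]
  | cons a w ih =>
    rcases eq_or_ne w [] with rfl | hw
    · rw [lieWord, S.lie_e_f]
      split_ifs
      · exact mem_borelSubmodule i
      · exact zero_mem _
    · rw [lieWord_cons f a hw, leibniz_lie, S.lie_e_f]
      refine add_mem ?_ ?_
      · split_ifs
        · have hw' := S.symm.lie_h_lieWord i w
          rw [Pi.neg_apply, neg_lie, neg_eq_iff_eq_neg] at hw'
          exact hw' ▸ neg_mem (zsmul_mem (lieWord_mem_borelSubmodule w) _)
        · rw [zero_lie]
          exact zero_mem _
      · rw [← borelSubmodule_neg] at ih ⊢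
        exact S.symm.lie_mem_borelSubmodule a ih

theorem lie_mem_borelSubmodule_sup (S : IsWeakSerreFamily A h e f) (i : ι) {x : L}
    (hx : x ∈ borelSubmodule K h e ⊔ borelSubmodule K h f) :
    ⁅e i, x⁆ ∈ borelSubmodule K h e ⊔ borelSubmodule K h f := by
  obtain ⟨y, hy, z, hz, rfl⟩ := Submodule.mem_sup.1 hx
  rw [lie_add]
  refine add_mem (Submodule.mem_sup_left (S.lie_mem_borelSubmodule i hy)) ?_
  refine (borelSubmodule_le (fun j => ?_) fun w => ?_ : _ ≤ (borelSubmodule K h e ⊔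
    borelSubmodule K h f).comap (LieAlgebra.ad K L (e i) : L →ₗ[K] L)) hz
  · exact Submodule.mem_sup_left (S.lie_mem_borelSubmodule i (mem_borelSubmodule j))
  · exact Submodule.mem_sup_right (S.lie_lieWord_mem_borelSubmodule i w)

theorem borelSubmodule_sup_eq_top (S : IsWeakSerreFamily A h e f)
    (hspan : LieSubalgebra.lieSpan K L (Set.range e ∪ Set.range f) = ⊤) :
    borelSubmodule K h e ⊔ borelSubmodule K h f = ⊤ := by
  set N := borelSubmodule K h e ⊔ borelSubmodule K h f with hN
  have hstable (x : L) : ∀ y ∈ N, ⁅x, y⁆ ∈ N := by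
    have hx : x ∈ LieSubalgebra.lieSpan K L (Set.range e ∪ Set.range f) :=
      hspan ▸ LieSubalgebra.mem_top x
    induction hx using LieSubalgebra.lieSpan_induction with
    | mem x hx =>
      rcases hx with ⟨i, rfl⟩ | ⟨i, rfl⟩
      · exact fun y => S.lie_mem_borelSubmodule_sup i
      · rw [hN, ← borelSubmodule_neg (h := h) (e := e), ← borelSubmodule_neg (h := h) (e := f),
          sup_comm]
        exact fun y => S.symm.lie_mem_borelSubmodule_sup i
    | zero => simp
    | add u v _ _ hu hv => exact fun y hy => add_lie u v y ▸ add_mem (hu y hy) (hv y hy)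
    | smul t u _ hu => exact fun y hy => smul_lie t u y ▸ N.smul_mem t (hu y hy)
    | lie u v _ _ hu hv =>
      exact fun y hy => lie_lie u v y ▸ sub_mem (hu _ (hv y hy)) (hv _ (hu y hy))
  let N' : LieSubalgebra K L := { N with lie_mem' := fun {x y} _ hy => hstable x y hy }
  have hle : LieSubalgebra.lieSpan K L (Set.range e ∪ Set.range f) ≤ N' := by
    rw [LieSubalgebra.lieSpan_le]
    rintro _ (⟨i, rfl⟩ | ⟨i, rfl⟩)
    · exact Submodule.mem_sup_left (lieWord_mem_borelSubmodule [i])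
    · exact Submodule.mem_sup_right (lieWord_mem_borelSubmodule [i])
  exact eq_top_iff.2 fun x _ => hle (hspan ▸ LieSubalgebra.mem_top x)

end IsWeakSerreFamily

section WordSpace

variable [DecidableEq ι]

/-- The span of the coroots and iterated brackets of weight `β`. -/
def wordSpace (K : Type*) [CommRing K] [LieAlgebra K L] (h e f : ι → L)
    (β : ι → ℤ) : Submodule K L :=
  Submodule.span K ({x | ∃ w, wordContent w = β ∧ lieWord e w = x} ∪ {x | β = 0 ∧ x ∈ Set.range h} ∪
    {x | ∃ w, -wordContent w = β ∧ lieWord f w = x})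

theorem wordSpace_le {β : ι → ℤ} {N : Submodule K L}
    (he : ∀ w, wordContent w = β → lieWord e w ∈ N) (hh : β = 0 → ∀ i, h i ∈ N)
    (hf : ∀ w, -wordContent w = β → lieWord f w ∈ N) : wordSpace K h e f β ≤ N := by
  refine Submodule.span_le.2 ?_
  rintro _ ((⟨w, hw, rfl⟩ | ⟨hβ, i, rfl⟩) | ⟨w, hw, rfl⟩)
  exacts [he w hw, hh hβ i, hf w hw]

theorem wordSpace_zero_le : wordSpace K h e f 0 ≤ Submodule.span K (Set.range h) := by
  refine wordSpace_le (fun w hw => ?_) (fun _ i => Submodule.subset_span ⟨i, rfl⟩) fun w hw => ?_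
  · rw [wordContent_eq_zero.1 hw]
    exact zero_mem _
  · rw [wordContent_eq_zero.1 (neg_eq_zero.1 hw)]
    exact zero_mem _

theorem borelSubmodule_sup_le_iSup_wordSpace :
    borelSubmodule K h e ⊔ borelSubmodule K h f ≤ ⨆ β, wordSpace K h e f β := by
  have hh i : h i ∈ ⨆ β, wordSpace K h e f β :=
    Submodule.mem_iSup_of_mem 0 (Submodule.subset_span (.inl (.inr ⟨rfl, i, rfl⟩)))
  exact sup_le (borelSubmodule_le hh fun w => Submodule.mem_iSup_of_mem (wordContent w)
      (Submodule.subset_span (.inl (.inl ⟨w, rfl, rfl⟩))))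
    (borelSubmodule_le hh fun w => Submodule.mem_iSup_of_mem (-wordContent w)
      (Submodule.subset_span (.inr ⟨w, rfl, rfl⟩)))

namespace IsWeakSerreFamily

theorem exists_sum_eq (S : IsWeakSerreFamily A h e f)
    (hspan : LieSubalgebra.lieSpan K L (Set.range e ∪ Set.range f) = ⊤) (x : L) :
    ∃ (s : Finset (ι → ℤ)) (y : (ι → ℤ) → L),
      (∀ β, y β ∈ wordSpace K h e f β) ∧ ∑ β ∈ s, y β = x := by
  have hx : x ∈ ⨆ β, wordSpace K h e f β := borelSubmodule_sup_le_iSup_wordSpace <|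
    (S.borelSubmodule_sup_eq_top hspan).ge Submodule.mem_top
  obtain ⟨y, hy, rfl⟩ := (Submodule.mem_iSup_iff_exists_finsupp _ _).1 hx
  exact ⟨y.support, y, hy, rfl⟩

variable [Fintype ι]

theorem mem_latticeWeightSpace_single (S : IsWeakSerreFamily A h e f) (i : ι) :
    e i ∈ latticeWeightSpace K A h (Pi.single i 1) := fun j => by
  rw [S.he, Matrix.mulVec_single_one, Matrix.col_apply]

theorem lieWord_mem_latticeWeightSpace (S : IsWeakSerreFamily A h e f) (w : List ι) :
    lieWord e w ∈ latticeWeightSpace K A h (wordContent w) := fun i => by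
  rw [S.lie_h_lieWord, mulVec_wordContent]

theorem lieWord_mem_latticeWeightSpace_neg (S : IsWeakSerreFamily A h e f) (w : List ι) :
    lieWord f w ∈ latticeWeightSpace K A h (-wordContent w) := by
  rw [latticeWeightSpace_neg]
  exact S.symm.lieWord_mem_latticeWeightSpace w

theorem wordSpace_le_latticeWeightSpace (S : IsWeakSerreFamily A h e f) (β : ι → ℤ) :
    wordSpace K h e f β ≤ latticeWeightSpace K A h β :=
  wordSpace_le (fun w hw => hw ▸ S.lieWord_mem_latticeWeightSpace w)
    (fun hβ i j => by simp [hβ, S.hh])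
    fun w hw => hw ▸ S.lieWord_mem_latticeWeightSpace_neg w

theorem latticeWeightSpace_le_wordSpace {K : Type*} [Field K] [CharZero K]
    [LieAlgebra K L] (S : IsWeakSerreFamily A h e f)
    (hspan : LieSubalgebra.lieSpan K L (Set.range e ∪ Set.range f) = ⊤)
    (hA : ∀ b : ι → ℤ, A *ᵥ b = 0 → b = 0) (β : ι → ℤ) :
    latticeWeightSpace K A h β ≤ wordSpace K h e f β := by
  intro x hx
  obtain ⟨s, y, hy, hs⟩ := S.exists_sum_eq hspan x
  -- the weight components of `∑ γ ∈ s, y γ - x = 0` vanish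
  let z γ := (if γ ∈ s then y γ else 0) - if γ = β then x else 0
  have hz : ∀ γ ∈ insert β s, z γ ∈ latticeWeightSpace K A h γ := by
    refine fun γ _ => sub_mem ?_ ?_
    · split_ifs
      · exact S.wordSpace_le_latticeWeightSpace γ (hy γ)
      · exact zero_mem _
    · split_ifs with hγ
      · exact hγ ▸ hx
      · exact zero_mem _
  have hsum : ∑ γ ∈ insert β s, z γ = 0 := by
    rw [Finset.sum_sub_distrib, Finset.sum_ite_eq' _ β, if_pos (Finset.mem_insert_self _ _),
      Finset.sum_ite_mem, Finset.inter_eq_right.2 (Finset.subset_insert _ _), hs, sub_self]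
  have hzβ : z β = 0 := mem_of_sum_mem_of_mem_latticeWeightSpace hA (⊥ : Submodule K L) (by simp) hz
    (hsum ▸ zero_mem _) β (Finset.mem_insert_self _ _)
  simp only [z, if_pos, sub_eq_zero] at hzβ
  rw [← hzβ]
  split_ifs
  exacts [hy β, zero_mem _]

end IsWeakSerreFamily

end WordSpace

end Spanning

section SerreGenerators

open scoped Matrix

variable {K ι L : Type*} [Field K] [LieRing L] [LieAlgebra K L] {A : Matrix ι ι ℤ} {h e f : ι → L}

/-- A Serre family which generates the Lie algebra and whose raising elements do not vanish. -/
structure IsSerreGenerators (K : Type*) [Field K] [LieAlgebra K L] (A : Matrix ι ι ℤ)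
    (h e f : ι → L) : Prop extends IsSerreFamily A h e f where
  lieSpan_eq_top : LieSubalgebra.lieSpan K L (Set.range e ∪ Set.range f) = ⊤
  e_ne_zero : ∀ i, e i ≠ 0

namespace IsSerreGenerators

theorem exists_ad_e_pow_eq_zero (G : IsSerreGenerators K A h e f) (i : ι) (x : L) :
    ∃ n, (LieAlgebra.ad K L (e i) ^ n) x = 0 := by
  have htop : LieSubalgebra.engel K (e i) = ⊤ := by
    rw [eq_top_iff, ← G.lieSpan_eq_top, LieSubalgebra.lieSpan_le]
    rintro _ (⟨j, rfl⟩ | ⟨j, rfl⟩)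
    · refine (LieSubalgebra.mem_engel_iff K _ _).2 ⟨(-A i j).toNat + 1, ?_⟩
      rw [pow_succ, Module.End.mul_apply, ad_pow_apply_eq_iterate]
      exact G.serre_e i j
    · refine (LieSubalgebra.mem_engel_iff K _ _).2 ?_
      rcases eq_or_ne i j with rfl | hij
      · have hhe : ⁅e i, h i⁆ = -(A i i • e i) := by rw [← lie_skew, G.he]
        exact ⟨3, by simp [pow_succ', G.ef_same, hhe]⟩
      · exact ⟨1, by simp [G.ef_ne i j hij]⟩
  exact (LieSubalgebra.mem_engel_iff K _ _).1 (htop ▸ LieSubalgebra.mem_top x)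

variable [CharZero K]

theorem h_ne_zero (G : IsSerreGenerators K A h e f) (hA : IsSymmetricSimplyLaced A) (i : ι) :
    h i ≠ 0 := by
  intro h0
  have hhe := G.he i i
  rw [h0, zero_lie, hA.diag, ← Int.cast_smul_eq_zsmul K, eq_comm, smul_eq_zero] at hhe
  exact hhe.elim (by norm_num) (G.e_ne_zero i)

theorem f_ne_zero (G : IsSerreGenerators K A h e f) (hA : IsSymmetricSimplyLaced A) (i : ι) :
    f i ≠ 0 := by
  intro h0
  apply G.h_ne_zero hA i
  rw [← G.ef_same, h0, lie_zero]

theorem symm (G : IsSerreGenerators K A h e f) (hA : IsSymmetricSimplyLaced A) :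
    IsSerreGenerators K A (-h) f e where
  toIsWeakSerreFamily := G.toIsWeakSerreFamily.symm
  serre_e := G.serre_f
  serre_f := G.serre_e
  lieSpan_eq_top := by rw [Set.union_comm, G.lieSpan_eq_top]
  e_ne_zero := G.f_ne_zero hA

theorem isSl2Triple (G : IsSerreGenerators K A h e f) (hA : IsSymmetricSimplyLaced A) (i : ι) :
    IsSl2Triple (h i) (e i) (f i) where
  h_ne_zero := G.h_ne_zero hA i
  lie_e_f := G.ef_same i
  lie_h_e_nsmul := by rw [G.he, hA.diag]; exact ofNat_zsmul _ _
  lie_h_f_nsmul := by rw [G.hf, hA.diag]; exact congrArg _ (ofNat_zsmul _ _)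

theorem e_mem_of_h_mem (G : IsSerreGenerators K A h e f) (hA : IsSymmetricSimplyLaced A)
    (I : LieIdeal K L) {i : ι} (hi : h i ∈ I) : e i ∈ I := by
  have hhe : ⁅h i, e i⁆ ∈ I := lie_mem_left K L I _ _ hi
  rw [G.he, hA.diag] at hhe
  exact (zsmul_mem_iff_of_ne_zero I.toSubmodule two_ne_zero).1 hhe

theorem e_mem_of_f_mem (G : IsSerreGenerators K A h e f) (hA : IsSymmetricSimplyLaced A)
    (I : LieIdeal K L) {i : ι} (hi : f i ∈ I) : e i ∈ I :=
  G.e_mem_of_h_mem hA I (G.ef_same i ▸ lie_mem_right K L I _ _ hi)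

end IsSerreGenerators

end SerreGenerators

section SimpleReflection

open scoped Matrix

variable {ι : Type*} [Fintype ι] {A : Matrix ι ι ℤ}

theorem exists_pos_apply_and_pos_mulVec (P : IsPositiveSimplyLaced A) {β : ι → ℤ} (hβ : 0 ≤ β)
    (hβ0 : β ≠ 0) : ∃ i, 0 < β i ∧ 0 < (A *ᵥ β) i := by
  obtain ⟨i, -, hi⟩ := Finset.exists_lt_of_sum_lt (f := fun _ => (0 : ℤ))
    (g := fun j => β j * (A *ᵥ β) j) (s := Finset.univ)
    (by simpa [dotProduct] using P.dotProduct_mulVec_pos hβ0)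
  exact ⟨i, (hβ i).lt_of_ne fun h0 => by simp [← h0] at hi, pos_of_mul_pos_right hi (hβ i)⟩

variable [DecidableEq ι]

/-- The simple reflection `β ↦ β - ⟨β, αᵢ^∨⟩ αᵢ` of the root lattice, in coordinates with respect to
the simple roots. -/
def simpleReflection (A : Matrix ι ι ℤ) (i : ι) (β : ι → ℤ) : ι → ℤ :=
  β - Pi.single i ((A *ᵥ β) i)

theorem dotProduct_mulVec_simpleReflection (hA : IsSymmetricSimplyLaced A) (i : ι) (β : ι → ℤ) :
    simpleReflection A i β ⬝ᵥ A *ᵥ simpleReflection A i β = β ⬝ᵥ A *ᵥ β := by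
  have hsymm (n : ℤ) : β ⬝ᵥ A *ᵥ Pi.single i n = n * (A *ᵥ β) i := by
    have hAt : Aᵀ = A := Matrix.ext fun i j => hA.symm j i
    rw [Matrix.dotProduct_mulVec, ← Matrix.mulVec_transpose, hAt, dotProduct_single, mul_comm]
  have hself (n : ℤ) : (A *ᵥ Pi.single i n) i = 2 * n := by
    simp [hA.diag, mul_comm]
  rw [simpleReflection, Matrix.mulVec_sub, sub_dotProduct, dotProduct_sub, dotProduct_sub, hsymm,
    single_dotProduct, single_dotProduct, hself]
  ring

theorem sum_simpleReflection (i : ι) (β : ι → ℤ) :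
    ∑ j, simpleReflection A i β j = ∑ j, β j - (A *ᵥ β) i := by
  simp [simpleReflection, Finset.sum_sub_distrib]

theorem eq_single_of_simpleReflection_nonpos {i : ι} {β : ι → ℤ} (hβ : 0 ≤ β)
    (h : simpleReflection A i β ≤ 0) : β = Pi.single i (β i) := by
  ext j
  rcases eq_or_ne j i with rfl | hj
  · rw [Pi.single_eq_same]
  · have hj' := h j
    rw [simpleReflection, Pi.sub_apply, Pi.single_eq_of_ne hj, sub_zero] at hj'
    rw [Pi.single_eq_of_ne hj]
    exact hj'.antisymm (hβ j)

end SimpleReflection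

section Weights

open scoped Matrix

variable {K ι L : Type*} [Field K] [LieRing L] [LieAlgebra K L] [Fintype ι]
  {A : Matrix ι ι ℤ} {h e f : ι → L}

theorem ad_pow_mem_latticeWeightSpace {γ β : ι → ℤ} {x y : L}
    (hx : x ∈ latticeWeightSpace K A h γ) (hy : y ∈ latticeWeightSpace K A h β) (n : ℕ) :
    (LieAlgebra.ad K L x ^ n) y ∈ latticeWeightSpace K A h (β + n • γ) := by
  induction n with
  | zero => simpa using hy
  | succ n ih =>
    rw [pow_succ', Module.End.mul_apply, LieAlgebra.ad_apply, succ_nsmul', add_left_comm]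
    exact lie_mem_latticeWeightSpace hx ih

theorem ad_pow_mem_lieIdeal (I : LieIdeal K L) (x : L) {y : L} (hy : y ∈ I) (n : ℕ) :
    (LieAlgebra.ad K L x ^ n) y ∈ I := by
  induction n with
  | zero => exact hy
  | succ n ih =>
    rw [pow_succ', Module.End.mul_apply, LieAlgebra.ad_apply]
    exact lie_mem_right K L I _ _ ih

variable [CharZero K]

namespace IsSerreGenerators

theorem exists_mem_simpleReflection [DecidableEq ι] (G : IsSerreGenerators K A h e f)
    (hA : IsSymmetricSimplyLaced A) (I : LieIdeal K L) {β : ι → ℤ} {i : ι}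
    (hn : 0 ≤ (A *ᵥ β) i) {x : L} (hx : x ∈ latticeWeightSpace K A h β) (hxI : x ∈ I)
    (hx0 : x ≠ 0) :
    ∃ y ∈ latticeWeightSpace K A h (simpleReflection A i β), y ∈ I ∧ y ≠ 0 := by
  obtain ⟨n, hn⟩ := Int.eq_ofNat_of_zero_le hn
  -- climb the `i`-string through `x` to its top, then descend to the mirror image of `x`
  obtain ⟨p, hp, hp'⟩ := Nat.exists_not_and_succ_of_not_zero_of_exists
    (p := fun n => (LieAlgebra.ad K L (e i) ^ n) x = 0) hx0 (G.exists_ad_e_pow_eq_zero i x)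
  set y := (LieAlgebra.ad K L (e i) ^ p) x with hy
  have hprim : (G.isSl2Triple hA i).HasPrimitiveVectorWith y ((n + 2 * p : ℕ) : K) := by
    refine ⟨hp, ?_, ?_⟩
    · have hhx : ⁅h i, x⁆ = (n : K) • x := by
        rw [hx i, hn, natCast_zsmul, Nat.cast_smul_eq_nsmul]
      push_cast
      exact (G.isSl2Triple hA i).lie_h_pow_toEnd_e hhx p
    · rwa [pow_succ', Module.End.mul_apply] at hp'
  have hyβ : y ∈ latticeWeightSpace K A h (β + p • Pi.single i 1) :=
    ad_pow_mem_latticeWeightSpace (G.mem_latticeWeightSpace_single i) hx p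
  have hf : f i ∈ latticeWeightSpace K A h (-Pi.single i 1) := by
    rw [latticeWeightSpace_neg]
    exact G.toIsWeakSerreFamily.symm.mem_latticeWeightSpace_single i
  refine ⟨(LieAlgebra.ad K L (f i) ^ (n + p)) y, ?_,
    ad_pow_mem_lieIdeal I _ (ad_pow_mem_lieIdeal I _ hxI p) _,
    hprim.pow_toEnd_f_ne_zero_of_eq_nat rfl (by omega)⟩
  have hreflect : simpleReflection A i β = β + p • Pi.single i 1 + (n + p) • -Pi.single i 1 := by
    rw [simpleReflection, hn, ← mul_one ((n : ℕ) : ℤ), ← smul_eq_mul, Pi.single_smul]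
    module
  exact hreflect ▸ ad_pow_mem_latticeWeightSpace hf hyβ (n + p)

theorem exists_lieWord_ne_zero [DecidableEq ι] (G : IsSerreGenerators K A h e f)
    (P : IsPositiveSimplyLaced A) {β : ι → ℤ} (hβ : β ≠ 0) {x : L}
    (hx : x ∈ latticeWeightSpace K A h β) (hx0 : x ≠ 0) :
    (∃ w, wordContent w = β ∧ lieWord e w ≠ 0) ∨ ∃ w, -wordContent w = β ∧ lieWord f w ≠ 0 := by
  by_contra! hcon
  have hle : wordSpace K h e f β ≤ ⊥ :=
    wordSpace_le hcon.1 (fun h0 => absurd h0 hβ) hcon.2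
  exact hx0 (hle (G.latticeWeightSpace_le_wordSpace G.lieSpan_eq_top
    (fun _ => P.eq_zero_of_mulVec_eq_zero) β hx))

theorem nonneg_or_nonpos (G : IsSerreGenerators K A h e f) (P : IsPositiveSimplyLaced A)
    {β : ι → ℤ} {x : L} (hx : x ∈ latticeWeightSpace K A h β) (hx0 : x ≠ 0) : 0 ≤ β ∨ β ≤ 0 := by
  classical
  rcases eq_or_ne β 0 with rfl | hβ
  · exact .inl le_rfl
  rcases G.exists_lieWord_ne_zero P hβ hx hx0 with ⟨w, rfl, -⟩ | ⟨w, rfl, -⟩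
  · exact .inl (wordContent_nonneg w)
  · exact .inr (neg_nonpos.2 (wordContent_nonneg w))

theorem latticeWeightSpace_single_le [DecidableEq ι] (G : IsSerreGenerators K A h e f)
    (P : IsPositiveSimplyLaced A) {i : ι} {m : ℤ} (hm : 0 < m) :
    latticeWeightSpace K A h (Pi.single i m) ≤ if m = 1 then K ∙ e i else ⊥ := by
  have hpos : 0 < (Pi.single i m : ι → ℤ) := Pi.single_pos.2 hm
  refine (G.latticeWeightSpace_le_wordSpace G.lieSpan_eq_top
    (fun _ => P.eq_zero_of_mulVec_eq_zero) _).trans (wordSpace_le (fun w hw => ?_)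
    (fun h0 => absurd h0 hpos.ne') fun w hw => ?_)
  · have hrep := eq_replicate_of_wordContent_eq_single hw
    match hlen : w.length with
    | 0 => simp [List.length_eq_zero_iff.1 hlen, lieWord]
    | 1 =>
      rw [hrep, hlen, List.replicate_one] at hw ⊢
      have hm1 : m = 1 := by
        simpa [wordContent_singleton] using (congrFun hw i).symm
      rw [if_pos hm1]
      exact Submodule.mem_span_singleton_self _
    | n + 2 =>
      rw [hrep, hlen, lieWord_replicate]
      exact zero_mem _
  · exact absurd (hw ▸ neg_nonpos.2 (wordContent_nonneg w)) hpos.not_ge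

theorem dotProduct_mulVec_eq_two_and_exists_e_mem_of_nonneg (G : IsSerreGenerators K A h e f)
    (P : IsPositiveSimplyLaced A) (I : LieIdeal K L) {β : ι → ℤ} (hβ : 0 ≤ β) (hβ0 : β ≠ 0) {x : L}
    (hx : x ∈ latticeWeightSpace K A h β) (hxI : x ∈ I) (hx0 : x ≠ 0) :
    β ⬝ᵥ A *ᵥ β = 2 ∧ ∃ i, e i ∈ I := by
  classical
  induction hN : (∑ j, β j).toNat using Nat.strong_induction_on generalizing β x with
  | _ N ih =>
    obtain ⟨i, hβi, hi⟩ := exists_pos_apply_and_pos_mulVec P hβ hβ0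
    obtain ⟨y, hy, hyI, hy0⟩ :=
      G.exists_mem_simpleReflection P.toIsSymmetricSimplyLaced I hi.le hx hxI hx0
    have hform := dotProduct_mulVec_simpleReflection P.toIsSymmetricSimplyLaced i β
    rcases G.nonneg_or_nonpos P hy hy0 with hγ | hγ
    · have hγ0 : simpleReflection A i β ≠ 0 := fun h0 => by
        rw [h0, zero_dotProduct] at hform
        exact (P.dotProduct_mulVec_pos hβ0).ne hform
      have hsum := sum_simpleReflection (A := A) i β
      have hγsum := Finset.sum_nonneg fun j (_ : j ∈ Finset.univ) => hγ j
      exact hform ▸ ih _ (by omega) hγ hγ0 hy hyI hy0 rfl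
    · have hsingle := eq_single_of_simpleReflection_nonpos hβ hγ
      rw [hsingle] at hx
      have hle := G.latticeWeightSpace_single_le P hβi hx
      split_ifs at hle with hone
      · obtain ⟨c, rfl⟩ := Submodule.mem_span_singleton.1 hle
        refine ⟨?_, i, (I.toSubmodule.smul_mem_iff (left_ne_zero_of_smul hx0)).1 hxI⟩
        rw [hsingle, hone]
        simp [P.diag]
      · exact absurd hle hx0

end IsSerreGenerators

end Weights

section FiniteType

open scoped Matrix

variable {K ι L : Type*} [Field K] [LieRing L] [LieAlgebra K L] {A : Matrix ι ι ℤ}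
  {h e f : ι → L}

section Fintype

variable [Fintype ι]

theorem IsWeakSerreFamily.lie_sum_h_e (S : IsWeakSerreFamily A h e f) (c : ι → K) (j : ι) :
    ⁅∑ i, c i • h i, e j⁆ = (c ᵥ* A.map (Int.cast : ℤ → K)) j • e j := by
  simp only [sum_lie, smul_lie, S.he, Matrix.vecMul, dotProduct, Matrix.map_apply, Finset.sum_smul,
    mul_smul, Int.cast_smul_eq_zsmul]

variable [CharZero K]

theorem IsPositiveSimplyLaced.eq_zero_of_vecMul_eq_zero (P : IsPositiveSimplyLaced A) {c : ι → K}
    (hc : c ᵥ* A.map (Int.cast : ℤ → K) = 0) : c = 0 := by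
  classical
  refine Matrix.eq_zero_of_vecMul_eq_zero ?_ hc
  rw [← Int.cast_det]
  exact Int.cast_ne_zero.2 P.det_ne_zero

theorem IsSerreGenerators.exists_e_mem_of_mem_latticeWeightSpace (G : IsSerreGenerators K A h e f)
    (P : IsPositiveSimplyLaced A) (I : LieIdeal K L) {β : ι → ℤ} (hβ : β ≠ 0) {x : L}
    (hx : x ∈ latticeWeightSpace K A h β) (hxI : x ∈ I) (hx0 : x ≠ 0) : ∃ i, e i ∈ I := by
  rcases G.nonneg_or_nonpos P hx hx0 with hpos | hneg
  · exact (G.dotProduct_mulVec_eq_two_and_exists_e_mem_of_nonneg P I hpos hβ hx hxI hx0).2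
  · rw [← neg_neg β, latticeWeightSpace_neg] at hx
    obtain ⟨i, hi⟩ := ((G.symm P.toIsSymmetricSimplyLaced
      ).dotProduct_mulVec_eq_two_and_exists_e_mem_of_nonneg P I (neg_nonneg.2 hneg)
      (neg_ne_zero.2 hβ) hx hxI hx0).2
    exact ⟨i, G.e_mem_of_f_mem P.toIsSymmetricSimplyLaced I hi⟩

end Fintype

namespace IsSerreGenerators

variable [CharZero K] [Finite ι]

theorem linearIndependent_h (G : IsSerreGenerators K A h e f) (P : IsPositiveSimplyLaced A) :
    LinearIndependent K h := by
  have := Fintype.ofFinite ι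
  rw [Fintype.linearIndependent_iff]
  intro c hc
  refine congrFun (P.eq_zero_of_vecMul_eq_zero (funext fun j => ?_))
  have hcj := G.lie_sum_h_e c j
  rw [hc, zero_lie, eq_comm] at hcj
  exact (smul_eq_zero.1 hcj).resolve_right (G.e_ne_zero j)

theorem exists_e_mem_of_mem_span_h (G : IsSerreGenerators K A h e f)
    (P : IsPositiveSimplyLaced A) (I : LieIdeal K L) {x : L}
    (hx : x ∈ Submodule.span K (Set.range h)) (hxI : x ∈ I) (hx0 : x ≠ 0) : ∃ i, e i ∈ I := by
  have := Fintype.ofFinite ι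
  obtain ⟨c, rfl⟩ := (Submodule.mem_span_range_iff_exists_fun K).1 hx
  have hc : c ≠ 0 := by
    rintro rfl
    simp at hx0
  obtain ⟨j, hj⟩ := Function.ne_iff.1 (mt P.eq_zero_of_vecMul_eq_zero hc)
  have hje : ⁅∑ i, c i • h i, e j⁆ ∈ I := lie_mem_left K L I _ _ hxI
  rw [G.lie_sum_h_e] at hje
  exact ⟨j, (I.toSubmodule.smul_mem_iff hj).1 hje⟩

theorem exists_e_mem (G : IsSerreGenerators K A h e f) (P : IsPositiveSimplyLaced A)
    (I : LieIdeal K L) (hI : I ≠ ⊥) : ∃ i, e i ∈ I := by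
  have := Fintype.ofFinite ι
  classical
  obtain ⟨x, hxI, hx0⟩ := Submodule.exists_mem_ne_zero_of_ne_bot
    (mt (LieSubmodule.toSubmodule_eq_bot I).1 hI)
  obtain ⟨s, y, hy, hs⟩ := G.exists_sum_eq G.lieSpan_eq_top x
  have hyβ β := G.wordSpace_le_latticeWeightSpace β (hy β)
  have hyI := mem_of_sum_mem_of_mem_latticeWeightSpace (A := A) (h := h)
    (fun _ => P.eq_zero_of_mulVec_eq_zero) I.toSubmodule
    (fun i x hx => lie_mem_right K L I _ _ hx) (fun β _ => hyβ β) (hs ▸ hxI : _ ∈ I)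
  obtain ⟨β, hβs, hyβ0⟩ := Finset.exists_ne_zero_of_sum_ne_zero (hs.trans_ne hx0)
  rcases eq_or_ne β 0 with rfl | hβ
  · exact G.exists_e_mem_of_mem_span_h P I (wordSpace_zero_le (hy 0)) (hyI 0 hβs) hyβ0
  · exact G.exists_e_mem_of_mem_latticeWeightSpace P I hβ (hyβ β) (hyI β hβs) hyβ0

theorem finite_range_lieWord (G : IsSerreGenerators K A h e f) (P : IsPositiveSimplyLaced A) :
    (Set.range (lieWord e)).Finite := by
  have := Fintype.ofFinite ι
  classical
  have hfin : {w : List ι | wordContent w ⬝ᵥ A *ᵥ wordContent w = 2}.Finite := by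
    refine (P.finite_dotProduct_mulVec_eq 2).preimage' fun b _ => ?_
    refine (List.finite_length_eq ι (∑ i, b i).toNat).subset fun w hw => ?_
    rw [Set.mem_preimage, Set.mem_singleton_iff] at hw
    rw [Set.mem_ofPred_eq, ← hw, sum_wordContent, Int.toNat_natCast]
  refine ((hfin.image (lieWord e)).insert 0).subset ?_
  rintro _ ⟨w, rfl⟩
  refine or_iff_not_imp_left.2 fun hw0 => ⟨w, ?_, rfl⟩
  exact (G.dotProduct_mulVec_eq_two_and_exists_e_mem_of_nonneg P ⊤ (wordContent_nonneg w)
    (fun hw => hw0 (by rw [wordContent_eq_zero.1 hw]; rfl)) (G.lieWord_mem_latticeWeightSpace w)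
    (LieSubmodule.mem_top _) hw0).1

theorem finiteDimensional (G : IsSerreGenerators K A h e f) (P : IsPositiveSimplyLaced A) :
    FiniteDimensional K L := by
  refine ⟨?_⟩
  rw [← G.borelSubmodule_sup_eq_top G.lieSpan_eq_top]
  exact (Submodule.fg_span ((Set.finite_range h).union (G.finite_range_lieWord P))).sup
    (Submodule.fg_span ((Set.finite_range h).union
      ((G.symm P.toIsSymmetricSimplyLaced).finite_range_lieWord P)))

theorem hasTrivialRadical (G : IsSerreGenerators K A h e f) (P : IsPositiveSimplyLaced A) :
    LieAlgebra.HasTrivialRadical K L := by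
  rw [LieAlgebra.hasTrivialRadical_iff_no_abelian_ideals]
  intro I hI
  by_contra hne
  obtain ⟨i, hi⟩ := G.exists_e_mem P I hne
  have hhi : h i ∈ I := G.ef_same i ▸ lie_mem_left K L I _ _ hi
  have hhe : ⁅h i, e i⁆ = 0 :=
    congrArg Subtype.val (trivial_lie_zero I I ⟨h i, hhi⟩ ⟨e i, hi⟩)
  rw [(G.isSl2Triple P.toIsSymmetricSimplyLaced i).lie_h_e_smul K, smul_eq_zero] at hhe
  exact hhe.elim two_ne_zero (G.e_ne_zero i)

/-- The basis, in the sense of split semisimple Lie algebras, given by Serre generators. -/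
def lieBasis (G : IsSerreGenerators K A h e f) (P : IsPositiveSimplyLaced A) :
    LieAlgebra.Basis ι (LieSubalgebra.lieSpan K L (Set.range h)) where
  A := A
  h := h
  e := e
  f := f
  cartan_eq_lieSpan := rfl
  span_ef := G.lieSpan_eq_top
  linInd := G.linearIndependent_h P
  nondegen := by
    have := Fintype.ofFinite ι
    classical exact Matrix.nondegenerate_of_det_ne_zero P.det_ne_zero
  sl2 := G.isSl2Triple P.toIsSymmetricSimplyLaced
  lie_h_h := G.hh
  lie_h_e i j := by rw [G.he, P.symm]
  lie_h_f i j := by rw [G.hf, P.symm, neg_smul]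
  lie_e_f_ne := G.ef_ne

theorem isTriangularizable (G : IsSerreGenerators K A h e f) (P : IsPositiveSimplyLaced A) :
    LieModule.IsTriangularizable K (LieSubalgebra.lieSpan K L (Set.range h)) L := by
  have := Fintype.ofFinite ι
  classical
  refine ⟨fun ⟨x, hx⟩ => eq_top_iff.2 fun y _ => ?_⟩
  rw [← LieSubalgebra.mem_toSubmodule, (G.lieBasis P).coe_cartan_eq_span] at hx
  obtain ⟨c, rfl⟩ := (Submodule.mem_span_range_iff_exists_fun K).1 hx
  obtain ⟨s, z, hz, rfl⟩ := G.exists_sum_eq G.lieSpan_eq_top y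
  refine sum_mem fun β _ => Submodule.mem_iSup_of_mem (∑ i, c i * (A *ᵥ β) i) ?_
  refine Module.End.mem_maxGenEigenspace _ _ _ |>.2 ⟨1, ?_⟩
  have hlie : ⁅∑ i, c i • h i, z β⁆ = (∑ i, c i * ((A *ᵥ β) i : K)) • z β := by
    simp only [sum_lie, smul_lie, G.wordSpace_le_latticeWeightSpace β (hz β) _, Finset.sum_smul,
      mul_smul, Int.cast_smul_eq_zsmul]
  rw [pow_one, LinearMap.sub_apply, sub_eq_zero]
  exact hlie

theorem isSplitSemisimpleOfType (G : IsSerreGenerators K A h e f) (P : IsPositiveSimplyLaced A) :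
    IsSplitSemisimpleOfType K L A := by
  have := Fintype.ofFinite ι
  have := G.finiteDimensional P
  have := G.hasTrivialRadical P
  have := G.isTriangularizable P
  refine ⟨G.finiteDimensional P, inferInstance, _, (G.lieBasis P).isCartanSubalgebra,
    G.isTriangularizable P, (G.lieBasis P).base, (G.lieBasis P).baseSupportEquiv, fun i j => ?_⟩
  rw [(G.lieBasis P).cartanMatrix_base_eq, Matrix.reindex_apply, Matrix.submatrix_apply,
    Equiv.symm_apply_apply, Equiv.symm_apply_apply]
  rfl

end IsSerreGenerators

end FiniteType

theorem isSerreGenerators_serreGen {ι : Type*} [DecidableEq ι] (K : Type*) [Field K]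
    {A : Matrix ι ι ℤ} (hA : IsSymmetricSimplyLaced A) :
    IsSerreGenerators K A (serreGen K A ∘ .H) (serreGen K A ∘ .E) (serreGen K A ∘ .F) where
  toIsSerreFamily := isSerreFamily_serreGen K A
  lieSpan_eq_top := by
    rw [eq_top_iff, ← lieSpan_range_serreGen K A, LieSubalgebra.lieSpan_le]
    set S := Set.range (serreGen K A ∘ .E) ∪ Set.range (serreGen K A ∘ .F)
    have hE i : serreGen K A (.E i) ∈ LieSubalgebra.lieSpan K _ S :=
      LieSubalgebra.subset_lieSpan (.inl ⟨i, rfl⟩)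
    have hF i : serreGen K A (.F i) ∈ LieSubalgebra.lieSpan K _ S :=
      LieSubalgebra.subset_lieSpan (.inr ⟨i, rfl⟩)
    rintro _ ⟨i | i | i, rfl⟩
    · have hH : ⁅serreGen K A (.E i), serreGen K A (.F i)⁆ = serreGen K A (.H i) :=
        (isSerreFamily_serreGen K A).ef_same i
      exact hH ▸ LieSubalgebra.lie_mem _ (hE i) (hF i)
    · exact hE i
    · exact hF i
  e_ne_zero := serreGen_E_ne_zero hA

theorem ESeries.isPositiveSimplyLaced {k : ℕ} (hk : 3 ≤ k) (hk8 : k ≤ 8) :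
    IsPositiveSimplyLaced (ESeries.cartanMatrix k) :=
  ⟨isSymmetricSimplyLaced k, posDef_cartanMatrix hk hk8⟩

theorem ESeries.isSplitSemisimpleOfType (K : Type*) [Field K] [CharZero K] {k : ℕ} (hk : 3 ≤ k)
    (hk8 : k ≤ 8) : IsSplitSemisimpleOfType K (ESeries.E K k) (ESeries.cartanMatrix k) :=
  (isSerreGenerators_serreGen K (isSymmetricSimplyLaced k)).isSplitSemisimpleOfType
    (isPositiveSimplyLaced hk hk8)

theorem proposition4p2 :
    -- (i) finite-dimensional case
    (∀ k : ℕ, 3 ≤ k → k ≤ 8 →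
      IsSplitSemisimpleOfType ℂ (ESeries.E ℂ k) (ESeries.cartanMatrix k) ∧
      IsSplitSemisimpleOfType ℝ (ESeries.E ℝ k) (ESeries.cartanMatrix k) ∧
      ESeries.IsStandardSplitForm k ∧
      ESeries.IsTrivialCentralExtension k) ∧
    -- (ii) affine case
    (IsAffineType (ESeries.cartanMatrix 9) ∧
      IsRealization ℝ (ESeries.cartanMatrix 9) (ESeries.root 9) (ESeries.coroot 9) ∧
      (∀ (V : Type*) [AddCommGroup V] [Module ℝ V]
        (α : Fin 9 → Module.Dual ℝ V) (αv : Fin 9 → V),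
        IsRealization ℝ (ESeries.cartanMatrix 9) α αv →
        ∃ (Φ : ESeries.G 9 ≃ₗ⁅ℝ⁆ ChevalleyAlgebra ℝ α αv) (φ : ESeries.Cartan 9 ≃ₗ[ℝ] V),
          (∀ x, Φ (ESeries.gh 9 x) = ChevalleyAlgebra.gen ℝ α αv (.h (φ x))) ∧
          (∀ i, φ (ESeries.coroot 9 i) = αv i) ∧
          (∀ i x, α i (φ x) = ESeries.root 9 i x) ∧
          ∀ i, Φ (ESeries.ge 9 i) = ChevalleyAlgebra.gen ℝ α αv (.e i) ∧
            Φ (ESeries.gf 9 i) = ChevalleyAlgebra.gen ℝ α αv (.f i)) ∧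
      (∀ (W : Type*) [AddCommGroup W] [Module ℂ W]
        (α : Fin 9 → Module.Dual ℂ W) (αv : Fin 9 → W),
        IsRealization ℂ (ESeries.cartanMatrix 9) α αv →
        ∃ (Ψ : (ℂ ⊗[ℝ] ESeries.G 9) ≃ₗ⁅ℂ⁆ ChevalleyAlgebra ℂ α αv)
          (ψ : (ℂ ⊗[ℝ] ESeries.Cartan 9) ≃ₗ[ℂ] W),
          (∀ x, Ψ (1 ⊗ₜ[ℝ] ESeries.gh 9 x) =
            ChevalleyAlgebra.gen ℂ α αv (.h (ψ (1 ⊗ₜ[ℝ] x)))) ∧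
          (∀ i, ψ (1 ⊗ₜ[ℝ] ESeries.coroot 9 i) = αv i) ∧
          (∀ i x, α i (ψ (1 ⊗ₜ[ℝ] x)) = (ESeries.root 9 i x : ℂ)) ∧
          ∀ i, Ψ (1 ⊗ₜ[ℝ] ESeries.ge 9 i) = ChevalleyAlgebra.gen ℂ α αv (.e i) ∧
            Ψ (1 ⊗ₜ[ℝ] ESeries.gf 9 i) = ChevalleyAlgebra.gen ℂ α αv (.f i))) ∧
    -- (iii) indefinite case
    (∀ k : ℕ, 10 ≤ k →
      IsIndefiniteType (ESeries.cartanMatrix k) ∧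
      ESeries.IsStandardSplitForm k ∧
      ESeries.IsTrivialCentralExtension k) := by
  refine ⟨fun k hk hk8 => ⟨ESeries.isSplitSemisimpleOfType ℂ hk hk8,
      ESeries.isSplitSemisimpleOfType ℝ hk hk8, ESeries.isStandardSplitForm k,
      ESeries.isTrivialCentralExtension hk (by omega)⟩,
    ⟨ESeries.isAffineType_nine, ESeries.isRealization_nine, ?_, ?_⟩,
    fun k hk => ⟨ESeries.isIndefiniteType hk, ESeries.isStandardSplitForm k,
      ESeries.isTrivialCentralExtension (by omega) (by omega)⟩⟩
  · intro V _ _ α αv H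
    obtain ⟨φ, hv, hα⟩ := exists_equiv_of_isRealization ESeries.isRealization_nine H
      (ESeries.rank_cartanMatrix_nine_add_one ℝ) ESeries.cartanMatrix_mulVec_mark
      (ESeries.mark_pos 0).ne'
    obtain ⟨Φ, hΦ, hef⟩ := ChevalleyAlgebra.exists_equiv_of_linearEquiv φ hα hv
    exact ⟨Φ, φ, hΦ, hv, hα, hef⟩
  · intro W _ _ α αv H
    obtain ⟨ψ, hv, hα⟩ := exists_baseChange_equiv_of_isRealization ESeries.isRealization_nine H
      (ESeries.rank_cartanMatrix_nine_add_one ℝ) (ESeries.rank_cartanMatrix_nine_add_one ℂ)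
      ESeries.cartanMatrix_mulVec_mark (ESeries.mark_pos 0).ne'
    obtain ⟨Ψ, hΨ, hef⟩ := ChevalleyAlgebra.exists_baseChange_equiv ψ hα hv
    exact ⟨Ψ, ψ, hΨ, hv, hα, hef⟩
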